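/- Let $n,k\ge 1$ be integers and $[n]=\{1,\dots,n\}$. Call a family $\mathcal F$ of $2k$-element subsets of $[n]$ triangle-free if it has no three distinct members $A,B,C$ with $A\triangle B\triangle C=\emptyset$. 1. If $3k\le n\le 4k-1$ and $\mathcal F\subseteq\binom{[n]}{2k}$ is triangle-free, then $|\mathcal F|\le\binom{n-1}{2k-1}$. 2. This is sharp: if $n\le 4k-1$, then for every $x\in[n]$ the star $\{A\in\binom{[n]}{2k}: x\in A\}$ is triangle-free and has exactly $\binom{n-1}{2k-1}$ members. 3. There is an absolute constant $C$ such that, for all $k\ge 1$ and $n\ge 4k$, every triangle-free $\mathcal F\subseteq\binom{[n]}{2k}$ satisfies $|\mathcal F|\le\left(\frac12+\frac Ck\right)\binom{n}{2k}$. 4. This is asymptotically sharp: for $k\ge1$ and $n\ge 4k$ the family $\mathcal O_{n,k}=\{A\in\binom{[n]}{2k}: |A\cap\{1,\dots,\lfloor n/2\rfloor\}|\text{ is odd}\}$ is triangle-free, and $|\mathcal O_{n,k}|/\binom{n}{2k}\to\frac12$ as $n\to\infty$, uniformly over $1\le k\le n/4$. -/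

import Mathlib

open scoped symmDiff

/-- `F` contains no three distinct members whose symmetric difference is empty. -/
def TriangleFree {n : ℕ} (F : Finset (Finset (Fin n))) : Prop :=
  ∀ A ∈ F, ∀ B ∈ F, ∀ C ∈ F, A ≠ B → A ≠ C → B ≠ C → A ∆ B ∆ C ≠ ∅

/-- The `r`-element subsets of an `n`-element set. -/
def uniformSets (n r : ℕ) : Finset (Finset (Fin n)) :=
  (Finset.univ : Finset (Fin n)).powersetCard r

/-- The star: all `r`-element subsets that contain the element `x`. -/
def starFamily {n : ℕ} (r : ℕ) (x : Fin n) : Finset (Finset (Fin n)) :=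
  (uniformSets n r).filter (fun A => x ∈ A)

/-- The first `⌊n/2⌋` elements of the ground set. -/
def firstHalf (n : ℕ) : Finset (Fin n) :=
  Finset.univ.filter (fun i => i.val < n / 2)

/-- All `r`-element subsets that meet the first half in an odd number of elements. -/
def oddFamily (n r : ℕ) : Finset (Finset (Fin n)) :=
  (uniformSets n r).filter (fun A => Odd (A ∩ firstHalf n).card)

/-! For the first bound, put `m = n - 2k`, `t = 4k - n`, `D = C(2k,k) C(m,k)`, `N = C(n,2k)`, and
let `T` be the adjacency matrix of the `D`-regular graph joining 2k-sets that meet in `k` points.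
The neighbours of `A` pair off as `B`, `A ∆ B`; triangle-freeness lets a family containing `A` take
at most one of each pair, so it induces degrees at most `D/2`. A Hoffman-type argument finishes: if
`T + cI - dJ` is positive semidefinite with `c = tD/(2m)` and `dN = D + c`, testing it on the
indicator of the family gives size at most `N (D/2 + c)/(D + c) = N · 2k/n`, the size of a star.

The crux is that nontrivial eigenvalues of `T` are at least `-c`. An eigenspace is invariant under
permuting points, so it contains a nonzero vector antisymmetric in a maximal system of disjoint
pairs. Maximality makes it symmetric in the other points, hence an explicit sign product on 2k-sets.
Reading the eigenvalue equation at one set turns the eigenvalue into a signed average of products of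
two Krawtchouk values, one for `A` (length `2k`, central) and one for its complement (length `m`);
the three-term recurrence bounds these.

For `n ≥ 4k`, average over the (4k-1)-subsets: the density is at most `2k/(4k-1)`. The odd family is
triangle-free by parity, and the deviation of its density from 1/2 is a single Krawtchouk value, of
modulus `C(n/2, k)`, which is small against `C(n, 2k)`. -/

/-! ### Krawtchouk coefficients: generating function, recurrence, bounds -/

/-- The Krawtchouk coefficient: the coefficient of `X ^ k` in `(1 - X) ^ i * (1 + X) ^ (m - i)`. -/
noncomputable def krawtchoukCoeff (m k i : ℕ) : ℝ :=
  ((1 - Polynomial.X) ^ i * (1 + Polynomial.X) ^ (m - i) : Polynomial ℝ).coeff k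

/-- The sum over the `k`-subsets `P` of `W` of the sign `(-1) ^ |P ∩ Z|`. -/
noncomputable def signedSum {α : Type*} [DecidableEq α] (k : ℕ) (W Z : Finset α) : ℝ :=
  ∑ P ∈ W.powersetCard k, ∏ z ∈ Z, (if z ∈ P then (-1 : ℝ) else 1)

/-- Expand the product over `w ∈ W` of `1 ± X`, with minus exactly on `Z`: each `k`-subset
contributes its sign to the coefficient of `X ^ k`. -/
theorem signedSum_eq_krawtchoukCoeff {α : Type*} [DecidableEq α] (k : ℕ) {W Z : Finset α}
    (h : Z ⊆ W) : signedSum k W Z = krawtchoukCoeff W.card k Z.card := by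
  have h1 : ∏ w ∈ W, (1 + (if w ∈ Z then (-1 : Polynomial ℝ) else 1) * Polynomial.X) =
      (1 - Polynomial.X) ^ Z.card * (1 + Polynomial.X) ^ (W.card - Z.card) := by
    have : ∀ w ∈ W, (1 + (if w ∈ Z then (-1 : Polynomial ℝ) else 1) * Polynomial.X) =
        if w ∈ Z then 1 - Polynomial.X else 1 + Polynomial.X := by
      intro w _
      split_ifs <;> ring
    rw [Finset.prod_congr rfl this, Finset.prod_ite, Finset.prod_const, Finset.prod_const]
    congr 2
    · rw [Finset.filter_mem_eq_inter, Finset.inter_eq_right.2 h]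
    · rw [← Finset.sdiff_eq_filter, Finset.card_sdiff_of_subset h]
  rw [krawtchoukCoeff, ← h1, Finset.prod_one_add, Polynomial.finsetSum_coeff, signedSum,
    Finset.powersetCard_eq_filter, Finset.sum_filter]
  refine Finset.sum_congr rfl fun P hP => ?_
  have h2 : ∏ w ∈ P, (if w ∈ Z then (-1 : Polynomial ℝ) else 1) =
      Polynomial.C (∏ z ∈ Z, (if z ∈ P then (-1 : ℝ) else 1)) := by
    simp [Finset.inter_comm]
  rw [Finset.prod_mul_distrib, Finset.prod_const, h2, Polynomial.coeff_C_mul,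
    Polynomial.coeff_X_pow]
  simp [eq_comm]

theorem abs_signedSum_le {α : Type*} [DecidableEq α] (k : ℕ) (W Z : Finset α) :
    |signedSum k W Z| ≤ W.card.choose k := by
  refine (Finset.abs_sum_le_sum_abs _ _).trans ?_
  rw [← Finset.card_powersetCard, Finset.card_eq_sum_ones, Nat.cast_sum]
  refine Finset.sum_le_sum fun P _ => ?_
  rw [Finset.abs_prod]
  refine le_of_eq ?_
  rw [Finset.prod_congr rfl (g := fun _ => (1 : ℝ)) (fun z _ => by split_ifs <;> simp)]
  simp

theorem abs_krawtchoukCoeff_le {m k i : ℕ} (h : i ≤ m) :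
    |krawtchoukCoeff m k i| ≤ m.choose k := by
  obtain ⟨Z, hZ, hc⟩ := Finset.exists_subset_card_eq (s := Finset.range m) (n := i) (by simpa)
  have := abs_signedSum_le k (Finset.range m) Z
  rw [signedSum_eq_krawtchoukCoeff k hZ, hc] at this
  simpa using this

theorem krawtchoukCoeff_zero (m k : ℕ) : krawtchoukCoeff m k 0 = m.choose k := by
  simp [krawtchoukCoeff, Polynomial.coeff_one_add_X_pow]

/-- Substituting `-X` for `X` exchanges the two factors. -/
theorem krawtchoukCoeff_reflect {m k i : ℕ} (h : i ≤ m) :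
    krawtchoukCoeff m k (m - i) = (-1) ^ k * krawtchoukCoeff m k i := by
  have h1 : ((1 - Polynomial.X) ^ (m - i) * (1 + Polynomial.X) ^ (m - (m - i)) : Polynomial ℝ) =
      ((1 - Polynomial.X) ^ i * (1 + Polynomial.X) ^ (m - i) : Polynomial ℝ).comp
        (-Polynomial.X) := by
    simp [Nat.sub_sub_self h, ← sub_eq_add_neg, mul_comm]
  rw [krawtchoukCoeff, h1, show (-Polynomial.X : Polynomial ℝ) = Polynomial.C (-1) * Polynomial.X by simp,
    Polynomial.comp_C_mul_X_coeff, mul_comm, krawtchoukCoeff]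

/-- Differentiate the product at index `i + 1` and multiply by `2X = (1 + X) - (1 - X)`: the
products at the neighbouring indices appear, while `X d/dX` multiplies the coefficient of `X ^ k` by
`k`. -/
theorem krawtchoukCoeff_recurrence {m i : ℕ} (k : ℕ) (h : i + 1 < m) :
    ((m : ℝ) - (i + 1)) * krawtchoukCoeff m k (i + 2) =
      (m - 2 * k) * krawtchoukCoeff m k (i + 1) - (i + 1) * krawtchoukCoeff m k i := by
  obtain ⟨d, rfl⟩ := Nat.exists_eq_add_of_lt h
  have e0 : i + 1 + d + 1 - i = d + 2 := by omega
  have e1 : i + 1 + d + 1 - (i + 1) = d + 1 := by omega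
  have e2 : i + 1 + d + 1 - (i + 2) = d := by omega
  have key : (2 * (Polynomial.X * Polynomial.derivative
        ((1 - Polynomial.X) ^ (i + 1) * (1 + Polynomial.X) ^ (d + 1) : Polynomial ℝ))) =
      Polynomial.C ((i : ℝ) + d + 2) * ((1 - Polynomial.X) ^ (i + 1) * (1 + Polynomial.X) ^ (d + 1))
      - Polynomial.C ((i : ℝ) + 1) * ((1 - Polynomial.X) ^ i * (1 + Polynomial.X) ^ (d + 2))
      - Polynomial.C ((d : ℝ) + 1) * ((1 - Polynomial.X) ^ (i + 2) * (1 + Polynomial.X) ^ d) := by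
    simp only [Polynomial.derivative_mul, Polynomial.derivative_pow, map_sub, map_add,
      Polynomial.derivative_X, Polynomial.derivative_one, Nat.add_sub_cancel, map_natCast, map_one,
      Nat.cast_add, Nat.cast_one, map_ofNat]
    ring
  have hc := congrArg (fun p => Polynomial.coeff p k) key
  have hX : ∀ p : Polynomial ℝ, (Polynomial.X * Polynomial.derivative p).coeff k = k * p.coeff k := by
    intro p
    cases k with
    | zero => simp
    | succ k => rw [Polynomial.coeff_X_mul, Polynomial.coeff_derivative]; push_cast; ring
  have h2 : (2 : Polynomial ℝ) = Polynomial.C 2 := (map_ofNat Polynomial.C 2).symm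
  simp only [h2, Polynomial.coeff_sub, Polynomial.coeff_C_mul, hX] at hc
  simp only [krawtchoukCoeff, e0, e1, e2]
  push_cast
  linarith

theorem krawtchoukCoeff_one {m : ℕ} (k : ℕ) (h : 0 < m) :
    (m : ℝ) * krawtchoukCoeff m k 1 = (m - 2 * k) * m.choose k := by
  obtain ⟨d, rfl⟩ : ∃ d, m = d + 1 := ⟨m - 1, by omega⟩
  cases k with
  | zero => simp [krawtchoukCoeff, Polynomial.coeff_zero_eq_eval_zero]
  | succ k =>
    have h1 : krawtchoukCoeff (d + 1) (k + 1) 1 = d.choose (k + 1) - d.choose k := by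
      simp [krawtchoukCoeff, sub_mul, Polynomial.coeff_one_add_X_pow, Polynomial.coeff_X_mul]
    have h2 : ((d + 1 : ℕ) : ℝ) * d.choose k = (d + 1).choose (k + 1) * (k + 1) := by
      exact_mod_cast Nat.add_one_mul_choose_eq d k
    have h3 : ((d + 1).choose (k + 1) : ℝ) = d.choose k + d.choose (k + 1) := by
      exact_mod_cast Nat.choose_succ_succ d k
    rw [h1]
    have h4 : (d.choose (k + 1) : ℝ) = (d + 1).choose (k + 1) - d.choose k := by linarith
    rw [h4]
    push_cast at h2 ⊢
    linarith

/-- Here `m - 2(l + t) = -t`, so the recurrence propagates the bound as long as `t + i + 2 ≤ m - (i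
+ 2)`, that is `i + 2 ≤ l`; hence the range up to `l + 1`. Index 2 is separate because index 0
carries the full binomial. -/
theorem abs_krawtchoukCoeff_le_of_le {l t : ℕ} (ht : 1 ≤ t) {i : ℕ} (h1 : 1 ≤ i) (hi : i ≤ l + 1) :
    ((2 * l + t : ℕ) : ℝ) * |krawtchoukCoeff (2 * l + t) (l + t) i| ≤
      t * (2 * l + t).choose (l + t) := by
  obtain ⟨i, rfl⟩ : ∃ d, i = d + 1 := ⟨i - 1, by omega⟩
  clear h1
  set m := 2 * l + t with hm
  set K := krawtchoukCoeff m (l + t) with hK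
  set c : ℝ := (m.choose (l + t) : ℝ) with hc
  have hc0 : 0 ≤ c := by positivity
  have hm0 : (0 : ℝ) < m := by exact_mod_cast (by omega : 0 < m)
  have htR : (1 : ℝ) ≤ t := by exact_mod_cast ht
  have hmR : (m : ℝ) = 2 * l + t := by rw [hm]; push_cast; ring
  have e1 : (m : ℝ) * K 1 = -t * c := by
    rw [hK, krawtchoukCoeff_one _ (by omega), hmR]; push_cast; ring
  induction i using Nat.twoStepInduction with
  | zero =>
    rw [zero_add, ← abs_of_pos hm0, ← abs_mul, e1, neg_mul, abs_neg,
      abs_of_nonneg (by positivity)]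
  | one =>
    have hl : (1 : ℝ) ≤ l := by exact_mod_cast (by omega : 1 ≤ l)
    have hr := krawtchoukCoeff_recurrence (m := m) (i := 0) (l + t) (by omega)
    have h0 : K 0 = c := krawtchoukCoeff_zero _ _
    simp only [← hK, zero_add, h0, Nat.cast_zero] at hr
    push_cast at hr
    have e2 : ((m : ℝ) - 1) * (m * K 2) = (t ^ 2 - m) * c := by
      have : ((m : ℝ) - 1) * (m * K 2) = m * ((m - 1) * K 2) := by ring
      rw [this, hr]
      have : (m : ℝ) * ((m - 2 * (l + t)) * K 1 - 1 * c) =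
        (m - 2 * (l + t)) * (m * K 1) - m * c := by ring
      rw [this, e1, hmR]; ring
    have hp : (0 : ℝ) < m - 1 := by rw [hmR]; linarith
    have : (m - 1) * (m * |K 2|) ≤ ((m : ℝ) - 1) * (t * c) := by
      rw [← abs_of_pos hm0, ← abs_mul, abs_of_pos hm0]
      nth_rw 1 [← abs_of_pos hp]
      rw [← abs_mul, e2, abs_mul, abs_of_nonneg hc0, ← mul_assoc]
      refine mul_le_mul_of_nonneg_right ?_ hc0
      rw [abs_le, hmR]
      constructor <;> nlinarith
    exact le_of_mul_le_mul_left this hp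
  | more i ih1 ih2 =>
    have b1 := ih1 (by omega)
    have b2 := ih2 (by omega)
    have hr := krawtchoukCoeff_recurrence (m := m) (i := i + 1) (l + t) (by omega)
    rw [← hK] at hr
    push_cast at hr
    have hil : (i : ℝ) + 2 ≤ l := by exact_mod_cast (by omega : i + 2 ≤ l)
    have hp : (0 : ℝ) < m - (i + 2) := by rw [hmR]; linarith
    have e2 : ((m : ℝ) - (i + 2)) * K (i + 3) = -(t * K (i + 2)) - (i + 2) * K (i + 1) := by
      have : (m : ℝ) - 2 * (l + t) = -t := by rw [hmR]; ring
      rw [this] at hr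
      have h' : (m : ℝ) - (i + 2) = m - (i + 1 + 1) := by ring
      rw [h', show i + 3 = i + 1 + 2 from rfl, hr]; ring
    have e3 : ((m : ℝ) - (i + 2)) * |K (i + 3)| ≤ t * |K (i + 2)| + (i + 2) * |K (i + 1)| := by
      rw [← abs_of_pos hp, ← abs_mul, e2]
      refine (abs_sub _ _).trans (le_of_eq ?_)
      rw [abs_neg, abs_mul, abs_mul, abs_of_nonneg (by positivity : (0 : ℝ) ≤ t),
        abs_of_nonneg (by positivity : (0 : ℝ) ≤ (i : ℝ) + 2)]
    have : ((m : ℝ) - (i + 2)) * (m * |K (i + 3)|) ≤ (m - (i + 2)) * (t * c) := by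
      calc ((m : ℝ) - (i + 2)) * (m * |K (i + 3)|)
          = m * (((m : ℝ) - (i + 2)) * |K (i + 3)|) := by ring
        _ ≤ m * (t * |K (i + 2)| + (i + 2) * |K (i + 1)|) :=
          mul_le_mul_of_nonneg_left e3 hm0.le
        _ = t * (m * |K (i + 2)|) + (i + 2) * (m * |K (i + 1)|) := by ring
        _ ≤ t * (t * c) + (i + 2) * (t * c) := by gcongr
        _ = (t + (i + 2)) * (t * c) := by ring
        _ ≤ (m - (i + 2)) * (t * c) := by
          refine mul_le_mul_of_nonneg_right ?_ (by positivity)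
          rw [hmR]; linarith
    exact le_of_mul_le_mul_left this hp

/-- For length `2k` the middle term of the recurrence vanishes, so it links indices two apart; the
odd chain starts at zero. -/
theorem krawtchoukCoeff_central_odd {k u : ℕ} (h : u ≤ 2 * k) (hu : Odd u) :
    krawtchoukCoeff (2 * k) k u = 0 := by
  have h1 := krawtchoukCoeff_reflect (k := k) h
  obtain ⟨v, rfl⟩ := hu
  induction v with
  | zero =>
    have := krawtchoukCoeff_one (m := 2 * k) k (by omega)
    push_cast at this
    rw [sub_self, zero_mul] at this
    have hk : (2 * k : ℝ) ≠ 0 := by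
      have : 0 < k := by omega
      positivity
    simpa [hk] using this
  | succ v ih =>
    have ih := ih (by omega) (krawtchoukCoeff_reflect (by omega))
    have hr := krawtchoukCoeff_recurrence (m := 2 * k) (i := 2 * v + 1) k (by omega)
    rw [ih] at hr
    push_cast at hr
    rw [sub_self, zero_mul, mul_zero, sub_zero] at hr
    rcases mul_eq_zero.1 hr with h' | h'
    · have : (2 * v + 2 : ℝ) < 2 * k := by exact_mod_cast (by omega : 2 * v + 2 < 2 * k)
      linarith
    · exact h'

/-- The first step of the even chain gains the factor `1/(2k-1)`, later steps do not increase the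
modulus up to the middle, and reflection covers the other half. -/
theorem abs_krawtchoukCoeff_central_le {k u : ℕ} (h2 : 2 ≤ u) (hu : u + 2 ≤ 2 * k) :
    (2 * k - 1 : ℝ) * |krawtchoukCoeff (2 * k) k u| ≤ (2 * k).choose k := by
  have hk : (1 : ℝ) < k := by exact_mod_cast (by omega : 1 < k)
  have low : ∀ d : ℕ, d + 2 ≤ k + 1 →
      (2 * k - 1 : ℝ) * |krawtchoukCoeff (2 * k) k (d + 2)| ≤ (2 * k).choose k := by
    intro d
    have step : ∀ i : ℕ, i + 2 ≤ 2 * k → ((2 * k : ℝ) - (i + 1)) *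
        |krawtchoukCoeff (2 * k) k (i + 2)| = (i + 1) * |krawtchoukCoeff (2 * k) k i| := by
      intro i hi
      have hr := krawtchoukCoeff_recurrence (m := 2 * k) (i := i) k (by omega)
      push_cast at hr
      rw [sub_self, zero_mul, zero_sub] at hr
      have hp : (0 : ℝ) < 2 * k - (i + 1) := by
        have : (i + 2 : ℝ) ≤ 2 * k := by exact_mod_cast hi
        linarith
      rw [← abs_of_pos hp, ← abs_mul, hr, abs_neg, abs_mul, abs_of_nonneg (by positivity)]
    induction d using Nat.twoStepInduction with
    | zero =>
      intro _
      have := step 0 (by omega)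
      rw [krawtchoukCoeff_zero] at this
      norm_num at this
      rw [this]
    | one =>
      intro h
      rw [krawtchoukCoeff_central_odd (by omega) (by decide)]
      simp
    | more d ih _ =>
      intro h
      have hs := step (d + 2) (by omega)
      have := ih (by omega)
      have hd : (d + 3 : ℝ) ≤ k := by exact_mod_cast (by omega : d + 3 ≤ k)
      refine le_trans (mul_le_mul_of_nonneg_left ?_ (by linarith)) this
      push_cast at hs
      have hp : (0 : ℝ) < d + 2 + 1 := by positivity
      refine le_of_mul_le_mul_left ?_ hp
      rw [← hs]
      exact mul_le_mul_of_nonneg_right (by linarith) (abs_nonneg _)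
  rcases le_total u (k + 1) with h | h
  · obtain ⟨d, rfl⟩ : ∃ d, u = d + 2 := ⟨u - 2, by omega⟩
    exact low d h
  · have := low (2 * k - u - 2) (by omega)
    rw [show 2 * k - u - 2 + 2 = 2 * k - u by omega, krawtchoukCoeff_reflect (by omega), abs_mul,
      abs_pow, abs_neg, abs_one, one_pow, one_mul] at this
    exact this

/-! ### Bounding the eigenvalue sums -/

/-- Only even-sized subsets contribute, and they are half of all subsets; the empty one may be as
large as `a`. -/
theorem abs_sum_powerset_card_le {α : Type*} [DecidableEq α] {X : Finset α} (hX : X.Nonempty)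
    {f : ℕ → ℝ} {a b : ℝ} (hodd : ∀ u ≤ X.card, Odd u → f u = 0) (h0 : |f 0| ≤ a)
    (h2 : ∀ u, 2 ≤ u → u ≤ X.card → Even u → |f u| ≤ b) :
    |∑ U ∈ X.powerset, f U.card| ≤ 2 ^ X.card * (b / 2) + (a - b) := by
  refine (Finset.abs_sum_le_sum_abs _ _).trans ?_
  -- The indicator of even size is `(1 + (-1)^|U|)/2`, whose alternating part sums to zero.
  calc ∑ U ∈ X.powerset, |f U.card|
      ≤ ∑ U ∈ X.powerset, ((b / 2 + (-1) ^ U.card * (b / 2)) + if U = ∅ then a - b else 0) := by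
        refine Finset.sum_le_sum fun U hU => ?_
        have hc := Finset.card_le_card (Finset.mem_powerset.1 hU)
        rcases Nat.even_or_odd U.card with he | ho
        · rw [he.neg_one_pow]
          by_cases hU0 : U = ∅
          · subst hU0
            simp only [Finset.card_empty, if_true]
            linarith
          · rw [if_neg hU0]
            have : U.card ≠ 0 := by simpa using hU0
            have := h2 U.card (by obtain ⟨v, hv⟩ := he; omega) hc he
            linarith
        · have : U ≠ ∅ := by rintro rfl; simp at ho
          rw [hodd _ hc ho, ho.neg_one_pow, if_neg this]
          simp
    _ = 2 ^ X.card * (b / 2) + (a - b) := by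
        have h1 : ∑ U ∈ X.powerset, (-1 : ℝ) ^ U.card = 0 := by
          exact_mod_cast Finset.sum_powerset_neg_one_pow_card_of_nonempty hX
        rw [Finset.sum_add_distrib, Finset.sum_add_distrib, ← Finset.sum_mul, h1]
        simp

theorem abs_krawtchoukCoeff_odd_le {l i : ℕ} (h1 : 1 ≤ i) (hi : i ≤ 2 * l) :
    ((2 * l + 1 : ℕ) : ℝ) * |krawtchoukCoeff (2 * l + 1) (l + 1) i| ≤
      (2 * l + 1).choose (l + 1) := by
  rcases le_total i (l + 1) with h | h
  · simpa using abs_krawtchoukCoeff_le_of_le (l := l) le_rfl h1 h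
  · have := abs_krawtchoukCoeff_le_of_le (l := l) le_rfl (i := 2 * l + 1 - i) (by omega) (by omega)
    rw [krawtchoukCoeff_reflect (by omega), abs_mul, abs_pow, abs_neg, abs_one, one_pow, one_mul]
      at this
    simpa using this

/-- The sum is `2 ^ |X|` times a nontrivial eigenvalue of `T`, so this is the bound `tD/(2m)`. Odd
`|U|` drops out; for even `|U|` it normally suffices that one of the two factors is small. -/
theorem abs_sum_krawtchoukCoeff_mul_le {α : Type*} [DecidableEq α] {X : Finset α}
    (hX : X.Nonempty) {l t : ℕ} (ht : 1 ≤ t) (hXm : X.card ≤ 2 * l + t) :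
    (2 * ((2 * l + t : ℕ) : ℝ)) * |∑ U ∈ X.powerset, (-1) ^ U.card *
        krawtchoukCoeff (2 * (l + t)) (l + t) U.card *
        krawtchoukCoeff (2 * l + t) (l + t) (X.card - U.card)| ≤
      2 ^ X.card * t * ((2 * (l + t)).choose (l + t) * (2 * l + t).choose (l + t)) := by
  set m := 2 * l + t with hm
  set k := l + t with hk
  set c : ℝ := ((2 * k).choose k : ℝ) with hc
  set c' : ℝ := (m.choose k : ℝ) with hc'
  set j := X.card with hj
  have hj1 : 1 ≤ j := hX.card_pos
  have hm0 : (0 : ℝ) < m := by exact_mod_cast (by omega : 0 < m)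
  have htR : (1 : ℝ) ≤ t := by exact_mod_cast ht
  have hmR : (m : ℝ) = 2 * l + t := by rw [hm]; push_cast; ring
  have hkR : (k : ℝ) = l + t := by rw [hk]; push_cast; ring
  have hl0 : (0 : ℝ) ≤ l := by positivity
  have hc0 : 0 ≤ c := by positivity
  have hc'0 : 0 ≤ c' := by positivity
  set H := krawtchoukCoeff (2 * k) k with hH
  set K := krawtchoukCoeff m k with hK
  have hHodd : ∀ u ≤ j, Odd u → (-1) ^ u * H u * K (j - u) = 0 := by
    intro u hu ho
    rw [hH, krawtchoukCoeff_central_odd (by omega) ho]; simp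
  have hH0 : H 0 = c := krawtchoukCoeff_zero _ _
  have habs : ∀ u, |(-1) ^ u * H u * K (j - u)| = |H u| * |K (j - u)| := by
    intro u
    rw [abs_mul, abs_mul, abs_pow, abs_neg, abs_one, one_pow, one_mul]
  have hK1 : ∀ u, |K (j - u)| ≤ c' := fun u => abs_krawtchoukCoeff_le (by omega)
  have hH1 : ∀ u ≤ j, |H u| ≤ c := fun u hu => abs_krawtchoukCoeff_le (by omega)
  have hk1 : (0 : ℝ) < 2 * k - 1 := by rw [hkR]; linarith
  have hH2 : ∀ u, 2 ≤ u → u ≤ j → Even u → |H u| ≤ c / (2 * k - 1) := by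
    intro u h2 hu he
    rw [le_div_iff₀ hk1, mul_comm]
    exact abs_krawtchoukCoeff_central_le h2 (by obtain ⟨v, hv⟩ := he; omega)
  have hkm : 1 / (2 * k - 1 : ℝ) ≤ t / m := by
    rw [div_le_div_iff₀ hk1 hm0, hmR, hkR]; nlinarith
  have small : (∀ i, 1 ≤ i → i ≤ j → m * |K i| ≤ t * c') →
      (2 * (m : ℝ)) * |∑ U ∈ X.powerset, (-1) ^ U.card * H U.card * K (j - U.card)| ≤
        2 ^ j * t * (c * c') := by
    intro hsm
    have hsm' : ∀ i, 1 ≤ i → i ≤ j → |K i| ≤ t / m * c' := by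
      intro i h1 h2
      rw [div_mul_eq_mul_div, le_div_iff₀ hm0, mul_comm]
      exact hsm i h1 h2
    have := abs_sum_powerset_card_le hX (f := fun u => (-1) ^ u * H u * K (j - u))
      (a := t / m * (c * c')) (b := t / m * (c * c')) hHodd ?_ ?_
    · refine (mul_le_mul_of_nonneg_left this (by positivity)).trans (le_of_eq ?_)
      field_simp
      ring
    · rw [habs, hH0, abs_of_nonneg hc0]
      calc c * |K (j - 0)| ≤ c * (t / m * c') :=
            mul_le_mul_of_nonneg_left (hsm' _ (by omega) (by omega)) hc0
        _ = _ := by ring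
    · intro u h2 hu he
      rw [habs]
      -- At `u = j` the second factor has index 0 and is not small, so the central factor must be.
      rcases hu.eq_or_lt with h | h
      · calc |H u| * |K (j - u)| ≤ (c / (2 * k - 1)) * c' :=
              mul_le_mul (hH2 u h2 hu he) (hK1 u) (abs_nonneg _) (by positivity)
          _ = 1 / (2 * k - 1) * (c * c') := by ring
          _ ≤ _ := mul_le_mul_of_nonneg_right hkm (by positivity)
      · calc |H u| * |K (j - u)| ≤ c * (t / m * c') :=
              mul_le_mul (hH1 u hu) (hsm' _ (by omega) (by omega)) (abs_nonneg _) hc0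
          _ = _ := by ring
  rcases le_or_gt j (l + 1) with hjl | hjl
  · exact small fun i h1 h2 => abs_krawtchoukCoeff_le_of_le ht h1 (by omega)
  rcases ht.eq_or_lt with ht1 | ht2
  · subst ht1
    rcases hXm.eq_or_lt with hjm | hjm
    -- For `t = 1`, `j = m` the empty set may contribute fully, but then both factors are small
    -- elsewhere, giving `1/m²`, and `2(m + 1) ≤ 2 ^ m` leaves room.
    · have hmk : (2 * k - 1 : ℝ) = m := by rw [hmR, hkR]; push_cast; ring
      have := abs_sum_powerset_card_le hX (f := fun u => (-1) ^ u * H u * K (j - u))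
        (a := c * c') (b := 1 / m ^ 2 * (c * c')) hHodd ?_ ?_
      · refine (mul_le_mul_of_nonneg_left this (by positivity)).trans ?_
        have h2 : 2 * (m + 1) ≤ 2 ^ m := by
          have : l + 1 ≤ 2 ^ l := Nat.lt_two_pow_self
          rw [hm, pow_succ, pow_mul', pow_two]
          have hl : 1 ≤ l := by omega
          nlinarith
        have h2R : 2 * ((m : ℝ) + 1) ≤ 2 ^ m := by exact_mod_cast h2
        have hm1 : (1 : ℝ) ≤ m := by rw [hmR]; push_cast; linarith
        rw [← hj, hjm]
        have e : 2 * (m : ℝ) * (2 ^ m * (1 / (m : ℝ) ^ 2 * (c * c') / 2) +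
            (c * c' - 1 / (m : ℝ) ^ 2 * (c * c'))) =
            (2 ^ m + 2 * (m ^ 2 - 1)) / m * (c * c') := by
          field_simp
        rw [e]
        refine mul_le_mul_of_nonneg_right ?_ (by positivity)
        rw [div_le_iff₀ hm0]
        push_cast
        nlinarith
      · rw [habs, hH0, abs_of_nonneg hc0]
        exact mul_le_mul_of_nonneg_left (hK1 0) hc0
      · intro u h2 hu he
        rw [habs]
        have a1 := hH2 u h2 hu he
        rw [hmk] at a1
        have a2 : |K (j - u)| ≤ c' / m := by
          rw [le_div_iff₀ hm0, mul_comm]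
          exact abs_krawtchoukCoeff_odd_le (by obtain ⟨v, hv⟩ := he; omega) (by omega)
        calc |H u| * |K (j - u)| ≤ c / m * (c' / m) :=
              mul_le_mul a1 a2 (abs_nonneg _) (by positivity)
          _ = _ := by field_simp
    · refine small fun i h1 h2 => ?_
      rw [Nat.cast_one, one_mul]
      exact abs_krawtchoukCoeff_odd_le h1 (by omega)
  · have := abs_sum_powerset_card_le hX (f := fun u => (-1) ^ u * H u * K (j - u))
      (a := c * c') (b := 1 / (2 * k - 1) * (c * c')) hHodd ?_ ?_
    · refine (mul_le_mul_of_nonneg_left this (by positivity)).trans ?_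
      -- For `t ≥ 2` and `j ≥ l + 2` only the central factor is used; this inequality absorbs the
      -- empty set's full contribution.
      have h2 : 2 * m ≤ 2 ^ j * (t - 1) := by
        have h3 : l + 1 ≤ 2 ^ l := Nat.lt_two_pow_self
        have h4 : 2 ^ (l + 2) ≤ 2 ^ j := Nat.pow_le_pow_right (by norm_num) (by omega)
        obtain ⟨s, rfl⟩ : ∃ s, t = s + 2 := ⟨t - 2, by omega⟩
        have : 4 * (l + 1) ≤ 2 ^ j := by rw [pow_add] at h4; omega
        calc 2 * m ≤ 4 * (l + 1) * (s + 2 - 1) := by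
              rw [hm, show s + 2 - 1 = s + 1 by omega]; nlinarith
          _ ≤ _ := Nat.mul_le_mul_right _ this
      have h2R : 2 * (m : ℝ) ≤ 2 ^ j * (t - 1) := by
        have : ((t - 1 : ℕ) : ℝ) = t - 1 := by push_cast [Nat.cast_sub ht]; ring
        rw [← this]; exact_mod_cast h2
      have e : 2 * (m : ℝ) * (2 ^ j * (1 / (2 * (k : ℝ) - 1) * (c * c') / 2) +
          (c * c' - 1 / (2 * (k : ℝ) - 1) * (c * c'))) =
          (m * (2 ^ j + 2 * (2 * k - 2))) / (2 * k - 1) * (c * c') := by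
        field_simp
        ring
      rw [← hj, e]
      refine mul_le_mul_of_nonneg_right ?_ (by positivity)
      rw [div_le_iff₀ hk1]
      have e1 : (2 : ℝ) * k = m + t := by rw [hmR, hkR]; ring
      rw [e1]
      have : 0 ≤ (2 ^ j * ((t : ℝ) - 1) - 2 * m) * (m + t) :=
        mul_nonneg (by linarith) (by positivity)
      nlinarith
    · rw [habs, hH0, abs_of_nonneg hc0]
      exact mul_le_mul_of_nonneg_left (hK1 0) hc0
    · intro u h2 hu he
      rw [habs]
      calc |H u| * |K (j - u)| ≤ (c / (2 * k - 1)) * c' :=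
              mul_le_mul (hH2 u h2 hu he) (hK1 u) (abs_nonneg _) (by positivity)
          _ = _ := by ring

/-! ### Transpositions and antisymmetric vectors -/

/-- The image of a finset under the transposition of `x` and `y`. -/
def swapFinset {α : Type*} [DecidableEq α] (x y : α) (A : Finset α) : Finset α :=
  A.map (Equiv.swap x y).toEmbedding

section Swap

variable {α : Type*} [DecidableEq α]

theorem mem_swapFinset {x y z : α} {A : Finset α} :
    z ∈ swapFinset x y A ↔ Equiv.swap x y z ∈ A := by
  rw [swapFinset, Finset.mem_map_equiv, Equiv.symm_swap]

theorem card_swapFinset (x y : α) (A : Finset α) : (swapFinset x y A).card = A.card :=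
  Finset.card_map _

theorem swapFinset_swapFinset (x y : α) (A : Finset α) :
    swapFinset x y (swapFinset x y A) = A := by
  ext z
  simp [mem_swapFinset]

theorem swapFinset_self (x : α) (A : Finset α) : swapFinset x x A = A := by
  ext z
  simp [mem_swapFinset]

theorem swapFinset_comm {x y z w : α} (h1 : x ≠ z) (h2 : x ≠ w) (h3 : y ≠ z) (h4 : y ≠ w)
    (A : Finset α) : swapFinset x y (swapFinset z w A) = swapFinset z w (swapFinset x y A) := by
  ext u
  simp only [mem_swapFinset]
  have : Equiv.swap z w (Equiv.swap x y u) = Equiv.swap x y (Equiv.swap z w u) := by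
    simp only [Equiv.swap_apply_def]
    grind
  rw [this]

theorem swapFinset_eq_self {x y : α} {A : Finset α} (h : x ∈ A ↔ y ∈ A) : swapFinset x y A = A := by
  ext u
  rw [mem_swapFinset, Equiv.swap_apply_def]
  grind

theorem swapFinset_inter (x y : α) (A B : Finset α) :
    swapFinset x y A ∩ swapFinset x y B = swapFinset x y (A ∩ B) := by
  ext u
  simp [mem_swapFinset]

/-- The pairs `{x, y x}` with `x ∈ X` are disjoint, and `g` changes sign when the two elements of
one of these pairs are transposed. -/
structure IsAntisymmetric (X : Finset α) (y : α → α) (g : Finset α → ℝ) : Prop where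
  injOn : Set.InjOn y X
  notMem : ∀ x ∈ X, y x ∉ X
  neg : ∀ x ∈ X, ∀ A, g (swapFinset x (y x) A) = -g A

/-- Take a maximal system of pairs. If `g` changed under an outside transposition of `z` and `w`,
then `g` minus its transpose would be a nonzero vector of `V` antisymmetric in one more pair. -/
theorem exists_isAntisymmetric [Fintype α] {V : (Finset α → ℝ) → Prop}
    (hsub : ∀ f g, V f → V g → V (f - g))
    (hswap : ∀ f x y, V f → V fun A => f (swapFinset x y A)) {f : Finset α → ℝ} (hf : V f)
    (hne : f ≠ 0) :
    ∃ X y g, V g ∧ g ≠ 0 ∧ IsAntisymmetric X y g ∧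
      ∀ z w, z ∉ X → z ∉ X.image y → w ∉ X → w ∉ X.image y → ∀ A, g (swapFinset z w A) = g A := by
  classical
  obtain ⟨X, hX, hmax⟩ := Finset.exists_max_image
    (Finset.univ.filter fun X : Finset α => ∃ y g, V g ∧ g ≠ 0 ∧ IsAntisymmetric X y g)
    Finset.card ⟨∅, Finset.mem_filter.2 ⟨Finset.mem_univ _, id, f, hf, hne,
      by simp, by simp, by simp⟩⟩
  obtain ⟨-, y, g, hg, hg0, ha⟩ := Finset.mem_filter.1 hX
  refine ⟨X, y, g, hg, hg0, ha, fun z w hz hz' hw hw' => ?_⟩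
  by_contra! hcon
  obtain ⟨A, hA⟩ := hcon
  have hzw : z ≠ w := by
    rintro rfl
    exact hA (by rw [swapFinset_self])
  have hyz : ∀ x ∈ X, y x ≠ z := fun x hx h => hz' (Finset.mem_image.2 ⟨x, hx, h⟩)
  have hyw : ∀ x ∈ X, y x ≠ w := fun x hx h => hw' (Finset.mem_image.2 ⟨x, hx, h⟩)
  have hxz : ∀ x ∈ X, x ≠ z := fun x hx h => hz (h ▸ hx)
  have hxw : ∀ x ∈ X, x ≠ w := fun x hx h => hw (h ▸ hx)
  have hup : ∀ x ∈ X, Function.update y z w x = y x := fun x hx =>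
    Function.update_of_ne (hxz x hx) _ _
  have := hmax (insert z X) (Finset.mem_filter.2 ⟨Finset.mem_univ _, Function.update y z w,
    g - fun A => g (swapFinset z w A), hsub _ _ hg (hswap _ _ _ hg), ?_, ?_, ?_, ?_⟩)
  · rw [Finset.card_insert_of_notMem hz] at this
    omega
  · intro h
    have := congrFun h A
    simp only [Pi.sub_apply, Pi.zero_apply] at this
    exact hA (by linarith)
  · intro a ha1 b hb1 hab
    rcases Finset.mem_insert.1 ha1 with rfl | ha2 <;> rcases Finset.mem_insert.1 hb1 with rfl | hb2
    · rfl
    · rw [hup b hb2, Function.update_self] at hab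
      exact absurd hab.symm (hyw b hb2)
    · rw [hup a ha2, Function.update_self] at hab
      exact absurd hab (hyw a ha2)
    · rw [hup a ha2, hup b hb2] at hab
      exact ha.injOn ha2 hb2 hab
  · intro x hx
    rcases Finset.mem_insert.1 hx with rfl | hx
    · rw [Function.update_self]
      simp [hw, hzw.symm]
    · rw [hup x hx]
      simp [ha.notMem x hx, hyz x hx]
  · intro x hx B
    simp only [Pi.sub_apply]
    rcases Finset.mem_insert.1 hx with rfl | hx
    · rw [Function.update_self, swapFinset_swapFinset]
      ring
    · rw [hup x hx, ha.neg x hx, swapFinset_comm (hxz x hx).symm (hyz x hx).symm (hxw x hx).symm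
        (hyw x hx).symm, ha.neg x hx]
      ring

/-- If `B` fails to split some pair, swapping that pair fixes `B` and forces `g B = 0`. Otherwise
swaps within pairs, one sign each, bring all of `X` inside (`main`), and swaps of outside points
then reach `A` (`base`). -/
theorem IsAntisymmetric.eq_mul_prod {X : Finset α} {y : α → α} {g : Finset α → ℝ}
    (h : IsAntisymmetric X y g)
    (hinv : ∀ z w, z ∉ X → z ∉ X.image y → w ∉ X → w ∉ X.image y → ∀ A,
      g (swapFinset z w A) = g A)
    {A : Finset α} (hXA : X ⊆ A) (hyA : ∀ x ∈ X, y x ∉ A) {B : Finset α} (hB : B.card = A.card) :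
    g B = g A * ∏ x ∈ X, ((if y x ∈ B then (-1 : ℝ) else 1) - if x ∈ B then -1 else 1) / 2 := by
  have base : ∀ d : ℕ, ∀ B : Finset α, B.card = A.card → X ⊆ B → (∀ x ∈ X, y x ∉ B) →
      (B \ A).card = d → g B = g A := by
    intro d
    induction d with
    | zero =>
      intro B hB _ _ hd
      rw [Finset.eq_of_subset_of_card_le (Finset.sdiff_eq_empty_iff_subset.1
        (Finset.card_eq_zero.1 hd)) hB.ge]
    | succ d ih =>
      intro B hB hXB hyB hd
      have hAB : (A \ B).card = d + 1 := by rw [← hd, Finset.card_sdiff_comm hB]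
      obtain ⟨z, hz⟩ := Finset.card_pos.1 (by omega : 0 < (B \ A).card)
      obtain ⟨w, hw⟩ := Finset.card_pos.1 (by omega : 0 < (A \ B).card)
      rw [Finset.mem_sdiff] at hz hw
      have hz1 : z ∉ X := fun hh => hz.2 (hXA hh)
      have hw1 : w ∉ X := fun hh => hw.2 (hXB hh)
      have hz2 : z ∉ X.image y := by
        intro hh
        obtain ⟨x, hx, rfl⟩ := Finset.mem_image.1 hh
        exact hyB x hx hz.1
      have hw2 : w ∉ X.image y := by
        intro hh
        obtain ⟨x, hx, rfl⟩ := Finset.mem_image.1 hh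
        exact hyA x hx hw.1
      have hsw : swapFinset z w B \ A = (B \ A).erase z := by
        ext u
        rw [Finset.mem_sdiff, mem_swapFinset, Finset.mem_erase, Finset.mem_sdiff]
        by_cases huz : u = z
        · subst huz
          simp [hw.2]
        · by_cases huw : u = w
          · subst huw
            simp [hw.1]
          · rw [Equiv.swap_apply_of_ne_of_ne huz huw]
            simp [huz]
      rw [← hinv z w hz1 hz2 hw1 hw2]
      refine ih _ (by rw [card_swapFinset, hB]) ?_ ?_ ?_
      · intro x hx
        rw [mem_swapFinset, Equiv.swap_apply_of_ne_of_ne]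
        · exact hXB hx
        · rintro rfl; exact hz1 hx
        · rintro rfl; exact hw1 hx
      · intro x hx
        have hyx : y x ∈ X.image y := Finset.mem_image_of_mem y hx
        rw [mem_swapFinset, Equiv.swap_apply_of_ne_of_ne]
        · exact hyB x hx
        · intro hh; exact hz2 (hh ▸ hyx)
        · intro hh; exact hw2 (hh ▸ hyx)
      · rw [hsw, Finset.card_erase_of_mem (Finset.mem_sdiff.2 hz), hd]
        rfl
  by_cases hsplit : ∀ x ∈ X, ¬(x ∈ B ↔ y x ∈ B)
  · have main : ∀ d : ℕ, ∀ B : Finset α, B.card = A.card → (∀ x ∈ X, ¬(x ∈ B ↔ y x ∈ B)) →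
        (X \ B).card = d → g B = g A *
          ∏ x ∈ X, ((if y x ∈ B then (-1 : ℝ) else 1) - if x ∈ B then -1 else 1) / 2 := by
      intro d
      induction d with
      | zero =>
        intro B hB hs hd
        have hXB : X ⊆ B := Finset.sdiff_eq_empty_iff_subset.1 (Finset.card_eq_zero.1 hd)
        have hyB : ∀ x ∈ X, y x ∉ B := fun x hx hh => hs x hx (iff_of_true (hXB hx) hh)
        rw [base _ B hB hXB hyB rfl, Finset.prod_eq_one, mul_one]
        intro x hx
        rw [if_neg (hyB x hx), if_pos (hXB hx)]
        norm_num
      | succ d ih =>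
        intro B hB hs hd
        obtain ⟨z, hz⟩ := Finset.card_pos.1 (by omega : 0 < (X \ B).card)
        have hz' := Finset.mem_sdiff.1 hz
        have hyz : y z ∈ B := by
          have := hs z hz'.1
          tauto
        have hzy : y z ∉ X := h.notMem z hz'.1
        have m1 : z ∈ swapFinset z (y z) B := by rw [mem_swapFinset]; simpa
        have m2 : y z ∉ swapFinset z (y z) B := by rw [mem_swapFinset]; simpa using hz'.2
        have m3 : ∀ x ∈ X, x ≠ z → ((x ∈ swapFinset z (y z) B ↔ x ∈ B) ∧
            (y x ∈ swapFinset z (y z) B ↔ y x ∈ B)) := by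
          intro x hx hxz
          rw [mem_swapFinset, mem_swapFinset, Equiv.swap_apply_of_ne_of_ne hxz,
            Equiv.swap_apply_of_ne_of_ne]
          · exact ⟨Iff.rfl, Iff.rfl⟩
          · intro hh; exact h.notMem x hx (hh ▸ hz'.1)
          · intro hh; exact hxz (h.injOn hx hz'.1 hh)
          · intro hh; exact hzy (hh ▸ hx)
        have e := ih (swapFinset z (y z) B) (by rw [card_swapFinset, hB]) ?_ ?_
        · rw [h.neg z hz'.1] at e
          rw [← neg_neg (g B), e, ← mul_neg]
          congr 1
          rw [← Finset.mul_prod_erase X _ hz'.1, ← Finset.mul_prod_erase X _ hz'.1,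
            if_pos m1, if_neg m2, if_pos hyz, if_neg hz'.2, ← neg_mul]
          congr 1
          · norm_num
          · refine Finset.prod_congr rfl fun x hx => ?_
            have := m3 x (Finset.mem_of_mem_erase hx) (Finset.ne_of_mem_erase hx)
            simp only [this.1, this.2]
        · intro x hx
          by_cases hxz : x = z
          · subst hxz
            tauto
          · rw [(m3 x hx hxz).1, (m3 x hx hxz).2]
            exact hs x hx
        · have : X \ swapFinset z (y z) B = (X \ B).erase z := by
            ext u
            rw [Finset.mem_sdiff, Finset.mem_erase, Finset.mem_sdiff]
            by_cases huz : u = z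
            · subst huz; tauto
            · by_cases hu : u ∈ X
              · rw [(m3 u hu huz).1]; tauto
              · tauto
          rw [this, Finset.card_erase_of_mem hz, hd]
          rfl
    exact main _ B hB hsplit rfl
  · push Not at hsplit
    obtain ⟨x, hx, hxB⟩ := hsplit
    have h1 := h.neg x hx B
    rw [swapFinset_eq_self hxB] at h1
    rw [Finset.prod_eq_zero hx (by simp [hxB]), mul_zero]
    linarith

/-- Among the sets with `g ≠ 0` take one containing most of `X`: every pair is split, and swapping a
wrongly split pair would contain more. -/
theorem IsAntisymmetric.exists_ne_zero [Fintype α] {X : Finset α} {y : α → α}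
    {g : Finset α → ℝ} (h : IsAntisymmetric X y g) (hg : g ≠ 0) :
    ∃ A, g A ≠ 0 ∧ X ⊆ A ∧ ∀ x ∈ X, y x ∉ A := by
  classical
  obtain ⟨A₁, hA₁⟩ := Function.ne_iff.1 hg
  obtain ⟨A, hA, hmax⟩ := Finset.exists_max_image (Finset.univ.filter fun A => g A ≠ 0)
    (fun A => (X ∩ A).card) ⟨A₁, by simpa using hA₁⟩
  have hA := (Finset.mem_filter.1 hA).2
  have hsplit : ∀ x ∈ X, ¬(x ∈ A ↔ y x ∈ A) := by
    intro x hx hh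
    have := h.neg x hx A
    rw [swapFinset_eq_self hh] at this
    exact hA (by linarith)
  have hXA : X ⊆ A := by
    intro z hz
    by_contra hzA
    have hyz : y z ∈ A := by
      have := hsplit z hz
      tauto
    have := hmax (swapFinset z (y z) A) (Finset.mem_filter.2 ⟨Finset.mem_univ _, by
      rw [h.neg z hz]; simpa using hA⟩)
    have hlt : X ∩ A ⊂ X ∩ swapFinset z (y z) A := by
      rw [Finset.ssubset_iff_of_subset]
      · refine ⟨z, Finset.mem_inter.2 ⟨hz, ?_⟩, fun hh => hzA (Finset.mem_inter.1 hh).2⟩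
        rw [mem_swapFinset]; simpa
      · intro x hx
        obtain ⟨hx, hxA⟩ := Finset.mem_inter.1 hx
        refine Finset.mem_inter.2 ⟨hx, ?_⟩
        rw [mem_swapFinset, Equiv.swap_apply_of_ne_of_ne]
        · exact hxA
        · rintro rfl; exact hzA hxA
        · rintro rfl; exact h.notMem z hz hx
    have := Finset.card_lt_card hlt
    omega
  exact ⟨A, hA, hXA, fun x hx hh => hsplit x hx (iff_of_true (hXA hx) hh)⟩

end Swap

/-! ### Least eigenvalue of the intersection graph -/

section Spectral

variable {α : Type*} [Fintype α] [DecidableEq α]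

theorem sum_filter_inter_card {M : Type*} [AddCommMonoid M] (a b : ℕ) (B : Finset α)
    (φ : Finset α → M) :
    ∑ A ∈ Finset.univ.filter (fun A : Finset α => A.card = a + b ∧ (A ∩ B).card = a), φ A =
      ∑ P ∈ B.powersetCard a, ∑ Q ∈ Bᶜ.powersetCard b, φ (P ∪ Q) := by
  rw [← Finset.sum_product']
  refine Finset.sum_nbij' (fun A => (A ∩ B, A \ B)) (fun p => p.1 ∪ p.2) ?_ ?_ ?_ ?_ ?_
  · intro A hA
    obtain ⟨-, h1, h2⟩ := Finset.mem_filter.1 hA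
    have := Finset.card_inter_add_card_sdiff A B
    simp only [Finset.mem_product, Finset.mem_powersetCard]
    refine ⟨⟨Finset.inter_subset_right, h2⟩, ?_, by omega⟩
    intro x hx
    simp only [Finset.mem_compl]
    exact (Finset.mem_sdiff.1 hx).2
  · rintro ⟨P, Q⟩ hPQ
    simp only [Finset.mem_product, Finset.mem_powersetCard] at hPQ
    obtain ⟨⟨hP, hPc⟩, hQ, hQc⟩ := hPQ
    have hQB : Disjoint Q B := Finset.subset_compl_iff_disjoint_right.1 hQ
    have h1 : (P ∪ Q) ∩ B = P := by
      rw [Finset.union_inter_distrib_right, Finset.disjoint_iff_inter_eq_empty.1 hQB,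
        Finset.union_empty, Finset.inter_eq_left.2 hP]
    refine Finset.mem_filter.2 ⟨Finset.mem_univ _, ?_, by rw [h1, hPc]⟩
    rw [Finset.card_union_of_disjoint (hQB.symm.mono_left hP), hPc, hQc]
  · intro A _
    simp only
    rw [Finset.union_comm, Finset.sdiff_union_inter]
  · rintro ⟨P, Q⟩ hPQ
    simp only [Finset.mem_product, Finset.mem_powersetCard] at hPQ
    obtain ⟨⟨hP, -⟩, hQ, -⟩ := hPQ
    have hQB : Disjoint Q B := Finset.subset_compl_iff_disjoint_right.1 hQ
    ext x
    · have : x ∈ P → x ∈ B := fun hh => hP hh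
      have : x ∈ Q → x ∉ B := fun hh => Finset.disjoint_left.1 hQB hh
      simp only [Finset.mem_inter, Finset.mem_union]
      tauto
    · have : x ∈ P → x ∈ B := fun hh => hP hh
      have : x ∈ Q → x ∉ B := fun hh => Finset.disjoint_left.1 hQB hh
      simp only [Finset.mem_sdiff, Finset.mem_union]
      tauto
  · intro A _
    simp only
    rw [Finset.union_comm, Finset.sdiff_union_inter]

theorem card_filter_inter_card (a b : ℕ) (B : Finset α) :
    (Finset.univ.filter fun A : Finset α => A.card = a + b ∧ (A ∩ B).card = a).card =
      B.card.choose a * (Bᶜ).card.choose b := by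
  rw [Finset.card_eq_sum_ones, sum_filter_inter_card]
  simp

/-- The sum of an antisymmetric sign pattern over the sets that meet `A` in `k` elements,
expressed through Krawtchouk coefficients. -/
theorem sum_prod_sign_eq {k : ℕ} {X A : Finset α} {y : α → α} (hinj : Set.InjOn y X) (hXA : X ⊆ A)
    (hyA : ∀ x ∈ X, y x ∉ A) :
    ∑ B ∈ Finset.univ.filter (fun B : Finset α => B.card = k + k ∧ (B ∩ A).card = k),
      ∏ x ∈ X, ((if y x ∈ B then (-1 : ℝ) else 1) - if x ∈ B then -1 else 1) / 2 =
    (∑ U ∈ X.powerset, (-1) ^ U.card * krawtchoukCoeff A.card k U.card *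
      krawtchoukCoeff (Aᶜ).card k (X.card - U.card)) / 2 ^ X.card := by
  rw [sum_filter_inter_card]
  have h1 : ∀ P ∈ A.powersetCard k, ∀ Q ∈ Aᶜ.powersetCard k,
      ∏ x ∈ X, ((if y x ∈ P ∪ Q then (-1 : ℝ) else 1) - if x ∈ P ∪ Q then -1 else 1) / 2 =
      ∑ U ∈ X.powerset, (-1) ^ U.card * (∏ z ∈ U, if z ∈ P then (-1 : ℝ) else 1) *
        (∏ z ∈ (X \ U).image y, if z ∈ Q then (-1 : ℝ) else 1) / 2 ^ X.card := by
    intro P hP Q hQ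
    have hP := (Finset.mem_powersetCard.1 hP).1
    have hQ := (Finset.mem_powersetCard.1 hQ).1
    rw [Finset.prod_div_distrib, Finset.prod_const, ← Finset.sum_div]
    congr 1
    -- As `x ∈ A` and `y x ∉ A`, each factor is a sign from `P` plus a sign from `Q`; expanding over
    -- the set `U` of choices from `P` decouples the two sums.
    have h2 : ∀ x ∈ X, ((if y x ∈ P ∪ Q then (-1 : ℝ) else 1) - if x ∈ P ∪ Q then -1 else 1) =
        (-1) * (if x ∈ P then (-1 : ℝ) else 1) + if y x ∈ Q then -1 else 1 := by
      intro x hx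
      have e1 : y x ∈ P ∪ Q ↔ y x ∈ Q := by
        rw [Finset.mem_union, or_iff_right]
        exact fun hh => hyA x hx (hP hh)
      have e2 : x ∈ P ∪ Q ↔ x ∈ P := by
        rw [Finset.mem_union, or_iff_left]
        exact fun hh => Finset.mem_compl.1 (hQ hh) (hXA hx)
      simp only [e1, e2]
      ring
    rw [Finset.prod_congr rfl h2, Finset.prod_add]
    refine Finset.sum_congr rfl fun U _ => ?_
    rw [Finset.prod_mul_distrib, Finset.prod_const, Finset.prod_image]
    exact hinj.mono (by exact_mod_cast Finset.sdiff_subset)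
  rw [Finset.sum_congr rfl fun P hP => Finset.sum_congr rfl fun Q hQ => h1 P hP Q hQ]
  simp only [Finset.sum_comm (s := Aᶜ.powersetCard k) (t := X.powerset)]
  rw [Finset.sum_comm, Finset.sum_div]
  refine Finset.sum_congr rfl fun U hU => ?_
  have hUX := Finset.mem_powerset.1 hU
  have hc : ((X \ U).image y).card = X.card - U.card := by
    rw [Finset.card_image_of_injOn (hinj.mono (by exact_mod_cast Finset.sdiff_subset)),
      Finset.card_sdiff_of_subset hUX]
  have hsub : (X \ U).image y ⊆ Aᶜ := by
    intro z hz
    obtain ⟨x, hx, rfl⟩ := Finset.mem_image.1 hz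
    exact Finset.mem_compl.2 (hyA x (Finset.sdiff_subset hx))
  rw [← hc, ← signedSum_eq_krawtchoukCoeff k (hUX.trans hXA), ← signedSum_eq_krawtchoukCoeff k hsub,
    signedSum, signedSum, mul_assoc, Finset.sum_mul_sum, Finset.mul_sum, Finset.sum_div]
  refine Finset.sum_congr rfl fun P _ => ?_
  rw [Finset.mul_sum, Finset.sum_div]
  refine Finset.sum_congr rfl fun Q _ => ?_
  ring

/-- The matrix `T + c I - d J` on the `2k`-subsets, extended by zero, where `T` is the adjacency
matrix of the relation `|A ∩ B| = k`. -/
noncomputable def interMatrix (α : Type*) [DecidableEq α] (k : ℕ) (c d : ℝ) :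
    Matrix (Finset α) (Finset α) ℝ :=
  Matrix.of fun A B => if A.card = k + k ∧ B.card = k + k then
    (if (B ∩ A).card = k then 1 else 0) + (if A = B then c else 0) - d else 0

theorem interMatrix_isHermitian {α : Type*} [DecidableEq α] (k : ℕ) (c d : ℝ) : (interMatrix α k c d).IsHermitian := by
  ext A B
  simp only [interMatrix, Matrix.conjTranspose_apply, Matrix.of_apply, star_trivial,
    Finset.inter_comm A B, and_comm, eq_comm]

theorem interMatrix_mulVec (k : ℕ) (c d : ℝ) (g : Finset α → ℝ) {A : Finset α}
    (hA : A.card = k + k) : (interMatrix α k c d).mulVec g A =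
      ∑ B ∈ Finset.univ.filter (fun B : Finset α => B.card = k + k ∧ (B ∩ A).card = k), g B +
        c * g A - d * ∑ B ∈ Finset.univ.powersetCard (k + k), g B := by
  have h1 : ∀ B, interMatrix α k c d A B * g B =
      (if B.card = k + k ∧ (B ∩ A).card = k then g B else 0) + (if A = B then c * g A else 0) -
        (if B.card = k + k then d * g B else 0) := by
    intro B
    simp only [interMatrix, Matrix.of_apply, hA, true_and]
    by_cases hAB : A = B
    · subst hAB
      simp only [hA, true_and, if_true]
      split_ifs <;> ring
    · simp only [hAB, if_false]
      by_cases hB : B.card = k + k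
      · simp only [hB, true_and, if_true]
        split_ifs <;> ring
      · simp [hB]
  rw [Matrix.mulVec, dotProduct, Finset.sum_congr rfl fun B _ => h1 B, Finset.sum_sub_distrib,
    Finset.sum_add_distrib, Finset.sum_filter, Finset.mul_sum, Finset.powersetCard_eq_filter,
    Finset.sum_filter]
  simp

theorem interMatrix_mulVec_of_ne (k : ℕ) (c d : ℝ) (g : Finset α → ℝ) {A : Finset α}
    (hA : A.card ≠ k + k) : (interMatrix α k c d).mulVec g A = 0 := by
  rw [Matrix.mulVec, dotProduct]
  refine Finset.sum_eq_zero fun B _ => ?_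
  simp [interMatrix, hA]

theorem interMatrix_mulVec_swapFinset (k : ℕ) (c d : ℝ) (g : Finset α → ℝ) (x y : α)
    (A : Finset α) : (interMatrix α k c d).mulVec (fun B => g (swapFinset x y B)) A =
      (interMatrix α k c d).mulVec g (swapFinset x y A) := by
  rw [Matrix.mulVec, dotProduct, Matrix.mulVec, dotProduct]
  refine Finset.sum_nbij' (swapFinset x y) (swapFinset x y) (by simp) (by simp)
    (fun B _ => swapFinset_swapFinset x y B) (fun B _ => swapFinset_swapFinset x y B) ?_
  intro B _
  have hinj : swapFinset x y A = swapFinset x y B ↔ A = B :=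
    ⟨fun hh => by rw [← swapFinset_swapFinset x y A, hh, swapFinset_swapFinset], fun hh => by rw [hh]⟩
  simp only [interMatrix, Matrix.of_apply, card_swapFinset, swapFinset_inter, hinj]

/-- The choice of `d` kills constants on 2k-sets, and `c` bounds the modulus of every nontrivial
eigenvalue of `T`. -/
theorem interMatrix_posSemidef {l t : ℕ} (ht : 1 ≤ t)
    (hα : Fintype.card α = 2 * (l + t) + (2 * l + t)) {c d : ℝ}
    (hc : 2 * ((2 * l + t : ℕ) : ℝ) * c =
      t * ((2 * (l + t)).choose (l + t) * (2 * l + t).choose (l + t)))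
    (hd : d * (Fintype.card α).choose (2 * (l + t)) =
      (2 * (l + t)).choose (l + t) * (2 * l + t).choose (l + t) + c) :
    (interMatrix α (l + t) c d).PosSemidef := by
  set k := l + t with hk
  set M := interMatrix α k c d with hM
  have hH : M.IsHermitian := interMatrix_isHermitian k c d
  rw [hH.posSemidef_iff_eigenvalues_nonneg]
  intro i
  by_contra! hneg
  simp only [Pi.zero_apply] at hneg
  set μ := hH.eigenvalues i with hμ
  have hcompl : ∀ A : Finset α, A.card = k + k → (Aᶜ).card = 2 * l + t := by
    intro A hA
    rw [Finset.card_compl, hα, hA]; omega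
  have hne : (hH.eigenvectorBasis i : Finset α → ℝ) ≠ 0 := by
    intro h0
    apply hH.eigenvectorBasis.orthonormal.ne_zero i
    ext A
    exact congrFun h0 A
  -- Columns indexed by 2k-sets sum to `D + c - dN = 0`, so an eigenvector with `μ ≠ 0` has zero sum
  -- on 2k-sets and the `J` term disappears.
  have hsum : ∀ g : Finset α → ℝ, M.mulVec g = μ • g →
      ∑ B ∈ Finset.univ.powersetCard (k + k), g B = 0 := by
    intro g hg
    have h1 : ∑ A ∈ Finset.univ.powersetCard (k + k), M.mulVec g A = 0 := by
      have h2 : ∀ A ∈ (Finset.univ : Finset α).powersetCard (k + k), M.mulVec g A =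
          ∑ B ∈ Finset.univ.powersetCard (k + k), (if (B ∩ A).card = k then g B else 0) +
          c * g A - d * ∑ B ∈ Finset.univ.powersetCard (k + k), g B := by
        intro A hA
        rw [hM, interMatrix_mulVec k c d g (Finset.mem_powersetCard.1 hA).2, Finset.filter_and,
          ← Finset.sum_filter, Finset.powersetCard_eq_filter, Finset.powerset_univ,
          ← Finset.filter_and, Finset.filter_filter]
      rw [Finset.sum_congr rfl h2, Finset.sum_sub_distrib, Finset.sum_add_distrib, Finset.sum_comm,
        Finset.sum_const, ← Finset.mul_sum, Finset.card_powersetCard, nsmul_eq_mul,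
        Finset.card_univ]
      have h3 : ∀ B ∈ (Finset.univ : Finset α).powersetCard (k + k),
          ∑ A ∈ Finset.univ.powersetCard (k + k), (if (B ∩ A).card = k then g B else 0) =
          ((2 * k).choose k * (2 * l + t).choose k) * g B := by
        intro B hB
        have hBc := (Finset.mem_powersetCard.1 hB).2
        have h4 := card_filter_inter_card k k B
        rw [hcompl B hBc, hBc] at h4
        rw [← Finset.sum_filter, Finset.sum_const, nsmul_eq_mul, Finset.powersetCard_eq_filter,
          Finset.powerset_univ, Finset.filter_filter]
        simp only [Finset.inter_comm B]
        rw [h4, ← two_mul, Nat.cast_mul]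
      rw [Finset.sum_congr rfl h3, ← Finset.mul_sum]
      rw [two_mul] at hd
      rw [two_mul k]
      linear_combination (-(∑ B ∈ Finset.univ.powersetCard (k + k), g B)) * hd
    rw [hg] at h1
    simp only [Pi.smul_apply, smul_eq_mul, ← Finset.mul_sum] at h1
    exact (mul_eq_zero.1 h1).resolve_left hneg.ne
  obtain ⟨X, y, g, hg, hg0, ha, hinv⟩ := exists_isAntisymmetric
    (V := fun g : Finset α → ℝ => M.mulVec g = μ • g)
    (fun f g hf hg => by rw [Matrix.mulVec_sub, hf, hg, smul_sub])
    (fun f x y hf => by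
      ext A
      rw [hM, interMatrix_mulVec_swapFinset, ← hM, hf]
      rfl)
    (hH.mulVec_eigenvectorBasis i) hne
  obtain ⟨A, hgA, hXA, hyA⟩ := ha.exists_ne_zero hg0
  -- The zero extension only adds the eigenvalue 0, so an eigenvector for `μ < 0` lives on 2k-sets.
  have hAc : A.card = k + k := by
    by_contra hcon
    have := congrFun hg A
    rw [hM, interMatrix_mulVec_of_ne k c d g hcon, Pi.smul_apply, smul_eq_mul] at this
    exact (mul_ne_zero hneg.ne hgA) this.symm
  have hform : ∀ B : Finset α, B.card = k + k → g B = g A *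
      ∏ x ∈ X, ((if y x ∈ B then (-1 : ℝ) else 1) - if x ∈ B then -1 else 1) / 2 :=
    fun B hB => ha.eq_mul_prod hinv hXA hyA (hB.trans hAc.symm)
  have hs := hsum g hg
  -- With no pairs `g` would be a nonzero constant on 2k-sets, contradicting zero sum.
  have hX : X.Nonempty := by
    by_contra hcon
    rw [Finset.not_nonempty_iff_eq_empty] at hcon
    have h1 : ∀ B ∈ (Finset.univ : Finset α).powersetCard (k + k), g B = g A := by
      intro B hB
      rw [hform B (Finset.mem_powersetCard.1 hB).2, hcon]
      simp
    rw [Finset.sum_congr rfl h1, Finset.sum_const, nsmul_eq_mul, Finset.card_powersetCard,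
      Finset.card_univ] at hs
    rcases mul_eq_zero.1 hs with h2 | h2
    · rw [Nat.cast_eq_zero, Nat.choose_eq_zero_iff] at h2
      omega
    · exact hgA h2
  have hXm : X.card ≤ 2 * l + t := by
    rw [← hcompl A hAc, ← Finset.card_image_of_injOn ha.injOn]
    refine Finset.card_le_card fun z hz => ?_
    obtain ⟨x, hx, rfl⟩ := Finset.mem_image.1 hz
    exact Finset.mem_compl.2 (hyA x hx)
  have heig := congrFun hg A
  rw [hM, interMatrix_mulVec k c d g hAc, hs, Pi.smul_apply, smul_eq_mul, mul_zero, sub_zero,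
    Finset.sum_congr rfl fun B hB => hform B (Finset.mem_filter.1 hB).2.1, ← Finset.mul_sum,
    sum_prod_sign_eq ha.injOn hXA hyA, hcompl A hAc, hAc, ← two_mul] at heig
  set S := ∑ U ∈ X.powerset, (-1) ^ U.card * krawtchoukCoeff (2 * k) k U.card *
      krawtchoukCoeff (2 * l + t) k (X.card - U.card) with hS
  have hbound : 2 * ((2 * l + t : ℕ) : ℝ) * |S| ≤
      2 ^ X.card * t * ((2 * k).choose k * (2 * l + t).choose k) :=
    abs_sum_krawtchoukCoeff_mul_le hX ht hXm
  have hμS : S / 2 ^ X.card + c = μ := mul_left_cancel₀ hgA (by linarith)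
  have hm0 : (0 : ℝ) < ((2 * l + t : ℕ) : ℝ) := by exact_mod_cast (by omega : 0 < 2 * l + t)
  have h2 : (0 : ℝ) < 2 ^ X.card := by positivity
  have h3 : |S| ≤ 2 ^ X.card * c := by
    refine le_of_mul_le_mul_left (hbound.trans (le_of_eq ?_)) (by positivity : 0 < 2 * ((2 * l + t : ℕ) : ℝ))
    linear_combination -(2 ^ X.card : ℝ) * hc
  have h4 : -c ≤ S / 2 ^ X.card := by
    rw [le_div_iff₀ h2]
    have := neg_abs_le S
    linarith
  linarith

end Spectral

/-! ### Upper bounds for triangle-free families -/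

section Bound

variable {α : Type*} [Fintype α] [DecidableEq α]

/-- The involution `B ↦ A ∆ B` preserves the neighbours of `A`, and `A`, `B`, `A ∆ B` form a
triangle, so it maps the neighbours in `F` off `F`. -/
theorem two_mul_card_filter_inter_le {k : ℕ} (hk : 1 ≤ k) {F : Finset (Finset α)}
    (htf : ∀ A ∈ F, ∀ B ∈ F, ∀ C ∈ F, A ≠ B → A ≠ C → B ≠ C → A ∆ B ∆ C ≠ ∅)
    {A : Finset α} (hA : A ∈ F) (hAc : A.card = k + k) :
    2 * ((Finset.univ.filter fun B : Finset α => B.card = k + k ∧ (B ∩ A).card = k).filter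
      (· ∈ F)).card ≤ A.card.choose k * (Aᶜ).card.choose k := by
  rw [← card_filter_inter_card]
  set E := Finset.univ.filter fun B : Finset α => B.card = k + k ∧ (B ∩ A).card = k with hE
  set G := E.filter (· ∈ F) with hG
  have hinj : Function.Injective (A ∆ ·) := symmDiff_right_injective A
  have hint : ∀ B, (A ∆ B) ∩ A = A \ B := by
    intro B
    ext x
    simp only [Finset.mem_inter, Finset.mem_symmDiff, Finset.mem_sdiff]
    tauto
  have hself : ∀ B ∈ E, A ≠ B := by
    rintro B hB rfl
    have := (Finset.mem_filter.1 hB).2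
    rw [Finset.inter_self] at this
    omega
  have hmap : ∀ B ∈ E, A ∆ B ∈ E := by
    intro B hB
    obtain ⟨h1, h2⟩ := (Finset.mem_filter.1 hB).2
    have h3 := Finset.card_inter_add_card_sdiff A B
    have h4 := Finset.card_inter_add_card_sdiff B A
    rw [Finset.inter_comm] at h3
    refine Finset.mem_filter.2 ⟨Finset.mem_univ _, ?_, ?_⟩
    · rw [symmDiff_def, Finset.sup_eq_union, Finset.card_union_of_disjoint disjoint_sdiff_sdiff]
      omega
    · rw [hint]
      omega
  have hdisj : Disjoint G (G.image (A ∆ ·)) := by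
    rw [Finset.disjoint_right]
    intro C hC hCG
    obtain ⟨B, hB, rfl⟩ := Finset.mem_image.1 hC
    obtain ⟨hBE, hBF⟩ := Finset.mem_filter.1 hB
    obtain ⟨hCE, hCF⟩ := Finset.mem_filter.1 hCG
    refine htf A hA B hBF _ hCF (hself B hBE) (hself _ hCE) ?_ (symmDiff_self _)
    intro h
    have h0 : A = ⊥ := symmDiff_eq_right.1 h.symm
    rw [h0, Finset.bot_eq_empty, Finset.card_empty] at hAc
    omega
  have hsub : G ∪ G.image (A ∆ ·) ⊆ E := by
    refine Finset.union_subset (Finset.filter_subset _ _) fun C hC => ?_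
    obtain ⟨B, hB, rfl⟩ := Finset.mem_image.1 hC
    exact hmap B (Finset.mem_filter.1 hB).1
  have := Finset.card_le_card hsub
  rw [Finset.card_union_of_disjoint hdisj, Finset.card_image_of_injective _ hinj] at this
  omega

theorem card_le_choose_of_triangleFree {k : ℕ} (hk : 1 ≤ k) (h3 : 3 * k ≤ Fintype.card α)
    (h4 : Fintype.card α ≤ 4 * k - 1) {F : Finset (Finset α)} (hF : ∀ A ∈ F, A.card = 2 * k)
    (htf : ∀ A ∈ F, ∀ B ∈ F, ∀ C ∈ F, A ≠ B → A ≠ C → B ≠ C → A ∆ B ∆ C ≠ ∅) :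
    F.card ≤ (Fintype.card α - 1).choose (2 * k - 1) := by
  obtain ⟨l, t, ht, rfl, hα⟩ : ∃ l t : ℕ, 1 ≤ t ∧ k = l + t ∧
      -- The witnesses are `l = n - 3k` and `t = 4k - n`, so that `m = n - 2k`.
      Fintype.card α = 2 * (l + t) + (2 * l + t) :=
    ⟨Fintype.card α - 3 * k, 4 * k - Fintype.card α, by omega, by omega, by omega⟩
  rcases F.eq_empty_or_nonempty with rfl | hne
  · simp
  set k := l + t with hkdef
  set m := 2 * l + t with hm
  set n := Fintype.card α with hn
  set D : ℝ := (2 * k).choose k * m.choose k with hD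
  set N : ℝ := ((n.choose (2 * k) : ℕ) : ℝ) with hN
  have hm0 : (0 : ℝ) < m := by exact_mod_cast (by omega : 0 < m)
  have hN0 : 0 < N := Nat.cast_pos.2 (Nat.choose_pos (by omega))
  have hD0 : 0 < D := by
    have h1 := Nat.choose_pos (by omega : k ≤ 2 * k)
    have h2 := Nat.choose_pos (by omega : k ≤ m)
    exact mul_pos (by exact_mod_cast h1) (by exact_mod_cast h2)
  obtain ⟨c, hc⟩ : ∃ c : ℝ, 2 * (m : ℝ) * c = t * D := ⟨t * D / (2 * m), by field_simp⟩
  obtain ⟨d, hd⟩ : ∃ d : ℝ, d * N = D + c := ⟨(D + c) / N, by field_simp⟩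
  have hpsd := (interMatrix_posSemidef ht hα hc hd).dotProduct_mulVec_nonneg
    (fun A => if A ∈ F then (1 : ℝ) else 0)
  have hrow : ∀ A ∈ F, (interMatrix α k c d).mulVec (fun A => if A ∈ F then (1 : ℝ) else 0) A ≤
      D / 2 + c - d * F.card := by
    intro A hA
    have hAc : A.card = k + k := by rw [hF A hA, two_mul]
    have hAm : (Aᶜ).card = m := by rw [Finset.card_compl, ← hn, hα, hAc]; omega
    rw [interMatrix_mulVec k c d _ hAc, if_pos hA, mul_one]
    have h1 : ∑ B ∈ Finset.univ.powersetCard (k + k), (if B ∈ F then (1 : ℝ) else 0) = F.card := by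
      rw [← Finset.sum_filter, Finset.sum_const, nsmul_eq_mul, mul_one, Finset.filter_mem_eq_inter,
        Finset.inter_eq_right.2]
      intro B hB
      exact Finset.mem_powersetCard.2 ⟨Finset.subset_univ _, by rw [hF B hB, two_mul]⟩
    have h2 := two_mul_card_filter_inter_le hk htf hA hAc
    rw [hAm, hAc, ← two_mul] at h2
    have h2R := Nat.cast_le (α := ℝ).2 h2
    rw [Nat.cast_mul, Nat.cast_mul, ← hD, Nat.cast_ofNat] at h2R
    rw [h1, ← Finset.sum_filter, Finset.sum_const, nsmul_eq_mul, mul_one]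
    rw [← two_mul]
    linarith
  have htot : 0 ≤ F.card * (D / 2 + c - d * F.card) := by
    refine hpsd.trans ?_
    rw [dotProduct, ← nsmul_eq_mul, ← Finset.sum_const]
    simp only [Pi.star_apply, star_trivial, ite_mul, one_mul, zero_mul]
    rw [← Finset.sum_filter, Finset.filter_mem_eq_inter, Finset.univ_inter]
    exact Finset.sum_le_sum hrow
  have hF0 : (0 : ℝ) < F.card := by exact_mod_cast hne.card_pos
  have h5 : d * F.card ≤ D / 2 + c := by
    have := nonneg_of_mul_nonneg_right htot hF0
    linarith
  have h6 : (F.card : ℝ) * n ≤ 2 * k * N := by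
    have e1 : (D + c) * F.card ≤ N * (D / 2 + c) := by
      rw [← hd]
      nlinarith
    -- Substituting `c = tD/(2m)` makes `D` cancel; `m + t = 2k` and `2m + t = n` then give the
    -- star's density.
    have e2 : D * (F.card * (2 * m + t)) ≤ D * ((m + t) * N) := by
      have := mul_le_mul_of_nonneg_left e1 (by positivity : (0 : ℝ) ≤ 2 * m)
      have e3 : 2 * (m : ℝ) * ((D + c) * F.card) = D * (F.card * (2 * m + t)) := by
        linear_combination (F.card : ℝ) * hc
      have e4 : 2 * (m : ℝ) * (N * (D / 2 + c)) = D * ((m + t) * N) := by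
        linear_combination N * hc
      rwa [e3, e4] at this
    have e5 := le_of_mul_le_mul_left e2 hD0
    have e6 : (n : ℝ) = 2 * m + t := by rw [hα, hm, hkdef]; push_cast; ring
    have e7 : (2 : ℝ) * k = m + t := by rw [hm, hkdef]; push_cast; ring
    rw [e6, e7]
    exact e5
  have h7 : n * (n - 1).choose (2 * k - 1) = n.choose (2 * k) * (2 * k) := by
    have := Nat.add_one_mul_choose_eq (n - 1) (2 * k - 1)
    rwa [show n - 1 + 1 = n by omega, show 2 * k - 1 + 1 = 2 * k by omega] at this
  have h8 : F.card * n ≤ 2 * k * n.choose (2 * k) := by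
    rw [hN] at h6
    exact_mod_cast h6
  refine Nat.le_of_mul_le_mul_left ?_ (by omega : 0 < n)
  rw [h7]
  linarith

/-- The averaged bound: the density of a triangle-free family does not exceed the one
on a ground set of `4k - 1` elements. -/
theorem card_mul_le_of_triangleFree {k : ℕ} (hk : 1 ≤ k) (h4 : 4 * k ≤ Fintype.card α)
    {F : Finset (Finset α)} (hF : ∀ A ∈ F, A.card = 2 * k)
    (htf : ∀ A ∈ F, ∀ B ∈ F, ∀ C ∈ F, A ≠ B → A ≠ C → B ≠ C → A ∆ B ∆ C ≠ ∅) :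
    F.card * (4 * k - 1) ≤ 2 * k * (Fintype.card α).choose (2 * k) := by
  set n := Fintype.card α with hn
  have hW : ∀ W ∈ (Finset.univ : Finset α).powersetCard (4 * k - 1),
      (F.filter (· ⊆ W)).card ≤ (4 * k - 2).choose (2 * k - 1) := by
    intro W hW
    have hWc : Fintype.card W = 4 * k - 1 := by
      rw [Fintype.card_coe]; exact (Finset.mem_powersetCard.1 hW).2
    have hmap : ∀ A : Finset α, A ⊆ W →
        (A.subtype (· ∈ W)).map (Function.Embedding.subtype _) = A := by
      intro A hA
      rw [Finset.subtype_map, Finset.filter_true_of_mem fun x hx => hA hx]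
    have hmapS : ∀ A B : Finset W, (A ∆ B).map (Function.Embedding.subtype _) =
        A.map (Function.Embedding.subtype _) ∆ B.map (Function.Embedding.subtype _) := by
      intro A B
      rw [symmDiff_def, symmDiff_def, Finset.sup_eq_union, Finset.sup_eq_union, Finset.map_union,
        Finset.map_sdiff, Finset.map_sdiff]
    have hmem : ∀ A : Finset W, A ∈ (F.filter (· ⊆ W)).image (Finset.subtype (· ∈ W)) →
        A.map (Function.Embedding.subtype _) ∈ F := by
      intro A hA
      obtain ⟨B, hB, rfl⟩ := Finset.mem_image.1 hA
      obtain ⟨hBF, hBW⟩ := Finset.mem_filter.1 hB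
      rwa [hmap B hBW]
    have := card_le_choose_of_triangleFree (α := W) hk (by omega) (by omega)
      (F := (F.filter (· ⊆ W)).image (Finset.subtype (· ∈ W)))
      (fun A hA => by rw [← hF _ (hmem A hA), Finset.card_map])
      (fun A hA B hB C hC hAB hAC hBC h0 => by
        have hinj := Finset.map_injective (Function.Embedding.subtype (· ∈ W))
        refine htf _ (hmem A hA) _ (hmem B hB) _ (hmem C hC) (hinj.ne hAB) (hinj.ne hAC)
          (hinj.ne hBC) ?_
        rw [← hmapS, ← hmapS, h0, Finset.map_empty])
    rwa [hWc, Finset.card_image_of_injOn, show 4 * k - 1 - 1 = 4 * k - 2 by omega] at this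
    intro A hA B hB hAB
    have hA := (Finset.mem_filter.1 hA).2
    have hB := (Finset.mem_filter.1 hB).2
    rw [← hmap A hA, hAB, hmap B hB]
  have hcount : ∀ A ∈ F, (((Finset.univ : Finset α).powersetCard (4 * k - 1)).filter
      (A ⊆ ·)).card = (n - 2 * k).choose (2 * k - 1) := by
    intro A hA
    have hc : (Aᶜ).card = n - 2 * k := by rw [Finset.card_compl, hF A hA]
    rw [← hc, ← Finset.card_powersetCard]
    refine Finset.card_nbij' (· \ A) (· ∪ A) ?_ ?_ ?_ ?_
    · intro W hW
      obtain ⟨hW, hAW⟩ := Finset.mem_filter.1 hW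
      refine Finset.mem_powersetCard.2 ⟨fun x hx => Finset.mem_compl.2 (Finset.mem_sdiff.1 hx).2, ?_⟩
      rw [Finset.card_sdiff_of_subset hAW, hF A hA, (Finset.mem_powersetCard.1 hW).2]
      omega
    · intro W hW
      obtain ⟨hW, hWc⟩ := Finset.mem_powersetCard.1 hW
      refine Finset.mem_filter.2 ⟨Finset.mem_powersetCard.2 ⟨Finset.subset_univ _, ?_⟩,
        Finset.subset_union_right⟩
      rw [Finset.card_union_of_disjoint (Finset.subset_compl_iff_disjoint_right.1 hW), hWc, hF A hA]
      omega
    · intro W hW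
      exact Finset.sdiff_union_of_subset (Finset.mem_filter.1 hW).2
    · intro W hW
      exact Finset.union_sdiff_cancel_right
        (Finset.subset_compl_iff_disjoint_right.1 (Finset.mem_powersetCard.1 hW).1)
  -- Count the pairs `A ⊆ W` with `A ∈ F` and `|W| = 4k - 1` in two ways.
  have hdouble : F.card * (n - 2 * k).choose (2 * k - 1) ≤
      n.choose (4 * k - 1) * (4 * k - 2).choose (2 * k - 1) := by
    have h1 := Finset.sum_card_bipartiteAbove_eq_sum_card_bipartiteBelow (s := F)
      (t := (Finset.univ : Finset α).powersetCard (4 * k - 1)) (r := (· ⊆ ·))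
    simp only [Finset.bipartiteAbove, Finset.bipartiteBelow] at h1
    rw [Finset.sum_congr rfl hcount, Finset.sum_const, smul_eq_mul] at h1
    rw [h1]
    refine (Finset.sum_le_sum hW).trans (le_of_eq ?_)
    rw [Finset.sum_const, Finset.card_powersetCard, Finset.card_univ, smul_eq_mul]
  have hch : n.choose (4 * k - 1) * (4 * k - 1).choose (2 * k) =
      n.choose (2 * k) * (n - 2 * k).choose (2 * k - 1) := by
    rw [Nat.choose_mul (by omega), show 4 * k - 1 - 2 * k = 2 * k - 1 by omega]
  have h7 : (4 * k - 1) * (4 * k - 2).choose (2 * k - 1) = (4 * k - 1).choose (2 * k) * (2 * k) := by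
    have := Nat.add_one_mul_choose_eq (4 * k - 2) (2 * k - 1)
    rwa [show 4 * k - 2 + 1 = 4 * k - 1 by omega, show 2 * k - 1 + 1 = 2 * k by omega] at this
  refine Nat.le_of_mul_le_mul_left ?_
    (Nat.choose_pos (by omega) : 0 < (n - 2 * k).choose (2 * k - 1))
  calc (n - 2 * k).choose (2 * k - 1) * (F.card * (4 * k - 1))
      = (F.card * (n - 2 * k).choose (2 * k - 1)) * (4 * k - 1) := by ring
    _ ≤ (n.choose (4 * k - 1) * (4 * k - 2).choose (2 * k - 1)) * (4 * k - 1) :=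
        Nat.mul_le_mul_right _ hdouble
    _ = n.choose (4 * k - 1) * ((4 * k - 1) * (4 * k - 2).choose (2 * k - 1)) := by ring
    _ = (n.choose (4 * k - 1) * (4 * k - 1).choose (2 * k)) * (2 * k) := by rw [h7]; ring
    _ = _ := by rw [hch]; ring

end Bound

/-! ### Stars and the odd family -/

theorem triangleFree_starFamily {n : ℕ} (r : ℕ) (x : Fin n) : TriangleFree (starFamily r x) := by
  intro A hA B hB C hC _ _ _ h0
  have hA := (Finset.mem_filter.1 hA).2
  have hB := (Finset.mem_filter.1 hB).2
  have hC := (Finset.mem_filter.1 hC).2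
  have : x ∈ A ∆ B ∆ C := by
    rw [Finset.mem_symmDiff, Finset.mem_symmDiff]
    tauto
  rw [h0] at this
  exact Finset.notMem_empty _ this

theorem card_starFamily {n r : ℕ} (hr : 1 ≤ r) (x : Fin n) :
    (starFamily r x).card = (n - 1).choose (r - 1) := by
  have h1 : ((Finset.univ : Finset (Fin n)).erase x).card = n - 1 := by
    rw [Finset.card_erase_of_mem (Finset.mem_univ _), Finset.card_univ, Fintype.card_fin]
  rw [← h1, ← Finset.card_powersetCard]
  refine Finset.card_nbij' (fun A => A.erase x) (fun A => insert x A) ?_ ?_ ?_ ?_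
  · intro A hA
    obtain ⟨hA, hx⟩ := Finset.mem_filter.1 hA
    refine Finset.mem_powersetCard.2 ⟨Finset.erase_subset_erase _ (Finset.subset_univ _), ?_⟩
    rw [Finset.card_erase_of_mem hx, (Finset.mem_powersetCard.1 hA).2]
  · intro A hA
    obtain ⟨hA, hc⟩ := Finset.mem_powersetCard.1 hA
    have hx : x ∉ A := fun hh => Finset.notMem_erase x _ (hA hh)
    refine Finset.mem_filter.2 ⟨Finset.mem_powersetCard.2 ⟨Finset.subset_univ _, ?_⟩,
      Finset.mem_insert_self _ _⟩
    rw [Finset.card_insert_of_notMem hx, hc]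
    omega
  · intro A hA
    exact Finset.insert_erase (Finset.mem_filter.1 hA).2
  · intro A hA
    exact Finset.erase_insert fun hh =>
      Finset.notMem_erase x _ ((Finset.mem_powersetCard.1 hA).1 hh)

/-- Parity of the intersection with a fixed set is additive under `∆`, and odd plus odd is not odd.
-/
theorem triangleFree_oddFamily (n r : ℕ) : TriangleFree (oddFamily n r) := by
  intro A hA B hB C hC _ _ _ h0
  have hA := (Finset.mem_filter.1 hA).2
  have hB := (Finset.mem_filter.1 hB).2
  have hC := (Finset.mem_filter.1 hC).2
  have hABC : A ∆ B = C := symmDiff_eq_bot.1 h0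
  set P := A ∩ firstHalf n
  set Q := B ∩ firstHalf n
  have h1 : C ∩ firstHalf n = (P \ Q) ∪ (Q \ P) := by
    rw [← hABC]
    ext x
    simp only [P, Q, Finset.mem_inter, Finset.mem_symmDiff, Finset.mem_union, Finset.mem_sdiff]
    tauto
  rw [h1, Finset.card_union_of_disjoint disjoint_sdiff_sdiff] at hC
  have h2 := Finset.card_inter_add_card_sdiff P Q
  have h3 := Finset.card_inter_add_card_sdiff Q P
  rw [Finset.inter_comm] at h3
  rw [Nat.odd_iff] at hA hB hC
  omega

theorem card_firstHalf (n : ℕ) : (firstHalf n).card = n / 2 := by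
  rw [firstHalf, Fin.card_filter_val_lt]
  omega

/-- The polynomial is `(1 - X²)^(n/2)`, times `1 + X` for odd `n`; the extra `X` does not touch even
coefficients. -/
theorem abs_krawtchoukCoeff_half {n k : ℕ} (hk : 1 ≤ k) :
    |krawtchoukCoeff n (2 * k) (n / 2)| = (n / 2).choose k := by
  set h := n / 2 with hh
  have h1 : ((1 - Polynomial.X) ^ h * (1 + Polynomial.X) ^ h : Polynomial ℝ) =
      Polynomial.expand ℝ 2 ((1 - Polynomial.X) ^ h) := by
    rw [← mul_pow]
    simp only [map_pow, map_sub, map_one, Polynomial.expand_X]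
    ring
  have h2 : |((1 - Polynomial.X) ^ h : Polynomial ℝ).coeff k| = h.choose k := by
    have := krawtchoukCoeff_reflect (k := k) (Nat.zero_le h)
    rw [krawtchoukCoeff_zero, krawtchoukCoeff, Nat.sub_zero, Nat.sub_self, pow_zero, mul_one] at this
    rw [this, abs_mul, abs_pow, abs_neg, abs_one, one_pow, one_mul, Nat.abs_cast]
  have h3 : krawtchoukCoeff n (2 * k) h = ((1 - Polynomial.X) ^ h : Polynomial ℝ).coeff k := by
    rcases Nat.even_or_odd' n with ⟨q, hq | hq⟩
    · rw [krawtchoukCoeff, show n - h = h by omega, h1, mul_comm 2 k,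
        Polynomial.coeff_expand_mul (by norm_num)]
    · obtain ⟨j, rfl⟩ : ∃ j, k = j + 1 := ⟨k - 1, by omega⟩
      rw [krawtchoukCoeff, show n - h = h + 1 by omega, pow_succ, ← mul_assoc, h1, mul_add, mul_one,
        Polynomial.coeff_add, show 2 * (j + 1) = 2 * j + 1 + 1 by ring, Polynomial.coeff_mul_X,
        Polynomial.coeff_expand (by norm_num), Polynomial.coeff_expand (by norm_num),
        if_pos (by omega), if_neg (by omega), add_zero]
      congr 1
      omega
  rw [h3, h2]

theorem le_choose_of_le_half {h k : ℕ} (hk : 1 ≤ k) (hkh : k ≤ h / 2) : h ≤ h.choose k := by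
  induction k, hk using Nat.le_induction with
  | base => simp
  | succ k _ ih => exact (ih (by omega)).trans (Nat.choose_le_succ_of_lt_half_left (by omega))

/-- The square is the diagonal term of Vandermonde's sum. -/
theorem choose_sq_le {n k : ℕ} : (n / 2).choose k * (n / 2).choose k ≤ n.choose (2 * k) := by
  calc (n / 2).choose k * (n / 2).choose k ≤ (n / 2 + n / 2).choose (2 * k) := by
        rw [Nat.add_choose_eq]
        exact Finset.single_le_sum (f := fun ij : ℕ × ℕ => (n / 2).choose ij.1 * (n / 2).choose ij.2)
          (fun _ _ => Nat.zero_le _)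
          (a := (k, k)) (by simp [two_mul])
    _ ≤ n.choose (2 * k) := Nat.choose_le_choose _ (by omega)

theorem two_mul_card_oddFamily (n r : ℕ) :
    2 * ((oddFamily n r).card : ℝ) = n.choose r - krawtchoukCoeff n r (n / 2) := by
  have h1 := signedSum_eq_krawtchoukCoeff r (Finset.subset_univ (firstHalf n))
  rw [card_firstHalf, Finset.card_univ, Fintype.card_fin] at h1
  rw [← h1, oddFamily, uniformSets, Finset.card_filter, signedSum]
  have h2 : ((n.choose r : ℕ) : ℝ) = ∑ A ∈ (Finset.univ : Finset (Fin n)).powersetCard r, 1 := by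
    simp
  rw [h2, ← Finset.sum_sub_distrib, Nat.cast_sum, Finset.mul_sum]
  refine Finset.sum_congr rfl fun A _ => ?_
  have h3 : ∏ z ∈ firstHalf n, (if z ∈ A then (-1 : ℝ) else 1) = (-1) ^ (A ∩ firstHalf n).card := by
    rw [Finset.prod_ite, Finset.prod_const, Finset.prod_const_one, mul_one,
      Finset.filter_mem_eq_inter, Finset.inter_comm]
  rw [h3]
  rcases Nat.even_or_odd (A ∩ firstHalf n).card with h | h
  · rw [h.neg_one_pow, if_neg (Nat.not_odd_iff_even.2 h)]
    simp
  · rw [h.neg_one_pow, if_pos h]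
    norm_num

/-- With `h = n/2`, the deviation is `C(h,k) / (2 C(n,2k))`, and `C(h,k) · h ≤ C(h,k)² ≤ C(n,2k)`.
-/
theorem abs_density_oddFamily_sub_half_le {n k : ℕ} (hk : 1 ≤ k) (hn : 4 * k ≤ n) :
    |((oddFamily n (2 * k)).card : ℝ) / (n.choose (2 * k) : ℝ) - 1 / 2| ≤
      1 / (2 * ((n / 2 : ℕ) : ℝ)) := by
  have h1 := two_mul_card_oddFamily n (2 * k)
  have h2 := abs_krawtchoukCoeff_half (n := n) hk
  have hN0 : (0 : ℝ) < n.choose (2 * k) := by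
    exact_mod_cast Nat.choose_pos (by omega)
  have hh0 : (0 : ℝ) < ((n / 2 : ℕ) : ℝ) := by exact_mod_cast (by omega : 0 < n / 2)
  have h3 : ((oddFamily n (2 * k)).card : ℝ) / (n.choose (2 * k) : ℝ) - 1 / 2 =
      -krawtchoukCoeff n (2 * k) (n / 2) / (2 * n.choose (2 * k)) := by
    field_simp
    linarith
  have h4 : (n / 2).choose k * (n / 2) ≤ n.choose (2 * k) :=
    (Nat.mul_le_mul_left _ (le_choose_of_le_half hk (by omega))).trans choose_sq_le
  have h4R : ((n / 2).choose k : ℝ) * ((n / 2 : ℕ) : ℝ) ≤ n.choose (2 * k) := by exact_mod_cast h4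
  rw [h3, abs_div, abs_neg, h2, abs_of_pos (by positivity : (0 : ℝ) < 2 * n.choose (2 * k)),
    div_le_div_iff₀ (by positivity) (by positivity)]
  linarith

theorem mainTheorem3 :
    -- the bound for `n ≤ 4k - 1`
    (∀ n k : ℕ, 1 ≤ k → 3 * k ≤ n → n ≤ 4 * k - 1 →
      ∀ F : Finset (Finset (Fin n)), F ⊆ uniformSets n (2 * k) → TriangleFree F →
        F.card ≤ (n - 1).choose (2 * k - 1)) ∧
    -- sharpness for `n ≤ 4k - 1`: every star is admissible and attains the bound
    (∀ n k : ℕ, 1 ≤ k → n ≤ 4 * k - 1 → ∀ x : Fin n,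
      TriangleFree (starFamily (2 * k) x) ∧
        (starFamily (2 * k) x).card = (n - 1).choose (2 * k - 1)) ∧
    -- the bound for `n ≥ 4k`, with an absolute implied constant
    (∃ C : ℝ, ∀ n k : ℕ, 1 ≤ k → 4 * k ≤ n →
      ∀ F : Finset (Finset (Fin n)), F ⊆ uniformSets n (2 * k) → TriangleFree F →
        (F.card : ℝ) ≤ (1 / 2 + C / (k : ℝ)) * (n.choose (2 * k) : ℝ)) ∧
    -- asymptotic sharpness for `n ≥ 4k`, uniformly in `k`
    ((∀ n k : ℕ, 1 ≤ k → 4 * k ≤ n → TriangleFree (oddFamily n (2 * k))) ∧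
      ∀ ε : ℝ, 0 < ε → ∃ N : ℕ, ∀ n k : ℕ, N ≤ n → 1 ≤ k → 4 * k ≤ n →
        |((oddFamily n (2 * k)).card : ℝ) / (n.choose (2 * k) : ℝ) - 1 / 2| ≤ ε) := by
  have hcard : ∀ {n k : ℕ} {F : Finset (Finset (Fin n))}, F ⊆ uniformSets n (2 * k) →
      ∀ A ∈ F, A.card = 2 * k := fun hF A hA => (Finset.mem_powersetCard.1 (hF hA)).2
  refine ⟨?_, ?_, ⟨1, ?_⟩, ?_, ?_⟩
  · intro n k hk h3 h4 F hF htf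
    simpa using card_le_choose_of_triangleFree hk (by simpa using h3) (by simpa using h4)
      (hcard hF) htf
  · intro n k hk _ x
    exact ⟨triangleFree_starFamily _ x, card_starFamily (by omega) x⟩
  · intro n k hk h4 F hF htf
    have h := card_mul_le_of_triangleFree hk (by simpa using h4) (hcard hF) htf
    rw [Fintype.card_fin] at h
    have hR : (F.card : ℝ) * (4 * k - 1) ≤ 2 * k * n.choose (2 * k) := by
      have e : ((4 * k - 1 : ℕ) : ℝ) = 4 * k - 1 := by
        rw [Nat.cast_sub (by omega)]
        push_cast
        ring
      rw [← e]
      exact_mod_cast h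
    have hk1 : (1 : ℝ) ≤ k := by exact_mod_cast hk
    have hN : (0 : ℝ) ≤ n.choose (2 * k) := by positivity
    refine le_of_mul_le_mul_right (hR.trans ?_) (by linarith : (0 : ℝ) < 4 * k - 1)
    -- The constant 1 is not tight: the slack is `7/2 - 1/k`.
    have : (2 * k : ℝ) ≤ (1 / 2 + 1 / k) * (4 * k - 1) := by
      have e : (1 / 2 + 1 / (k : ℝ)) * (4 * k - 1) = 2 * k + (7 / 2 - 1 / k) := by
        field_simp
        ring
      have : 1 / (k : ℝ) ≤ 1 := by
        rw [div_le_one (by linarith)]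
        exact hk1
      rw [e]
      linarith
    calc (2 * k : ℝ) * n.choose (2 * k) ≤ ((1 / 2 + 1 / k) * (4 * k - 1)) * n.choose (2 * k) :=
          mul_le_mul_of_nonneg_right this hN
      _ = _ := by ring
  · intro n k _ _
    exact triangleFree_oddFamily n _
  · intro ε hε
    refine ⟨2 * ⌈1 / ε⌉₊, fun n k hn hk h4 => (abs_density_oddFamily_sub_half_le hk h4).trans ?_⟩
    have h1 : 1 / ε ≤ ((n / 2 : ℕ) : ℝ) :=
      (Nat.le_ceil _).trans (by exact_mod_cast (by omega : ⌈1 / ε⌉₊ ≤ n / 2))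
    have h2 : 0 < 1 / ε := by positivity
    calc 1 / (2 * ((n / 2 : ℕ) : ℝ)) ≤ 1 / (1 / ε) :=
          one_div_le_one_div_of_le h2 (by linarith)
      _ = ε := one_div_one_div ε
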